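/- **Setting.** Let $M$ be a compact connected smooth Riemannian manifold (without boundary) whose first integral homology is free, $H_1(M;\mathbb Z)\cong\mathbb Z^b$, with basis $\Gamma_1,\dots,\Gamma_b$. Let $\pi:\tilde M_a\to M$ be the universal Abelian cover, i.e. the connected covering with $\pi_*\pi_1(\tilde M_a)=[\pi_1(M),\pi_1(M)]$. For $\vec n\in\mathbb Z^b$ let $\delta_{\vec n}$ be the deck transformation such that paths from $\tilde x$ to $\delta_{\vec n}\tilde x$ project to loops of homology class $\sum_i n_i\Gamma_i$. Let $\omega_1,\dots,\omega_b$ be smooth closed one-forms on $M$ (for instance harmonic ones) with $\int_{\Gamma_j}\omega_i=\delta_{ij}$, fix $\tilde x_0\in\tilde M_a$, and let $\tilde\iota:\tilde M_a\to\mathbb R^b$ be the Abel–Jacobi–Albanese map $\tilde\iota_i(\tilde x)=\int_{\tilde x_0}^{\tilde x}\pi^*\omega_i$, the integral being along any smooth path. Let $f:M\to M$ be continuous, let $\tilde f:\tilde M_a\to\tilde M_a$ be a lift of $f$, let $A$ be the integer matrix of $f_*$ on $H_1(M;\mathbb Z)$ in the basis $\Gamma_i$, and let $\Phi_A$ be the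 endomorphism of $\mathbb T^b=\mathbb R^b/\mathbb Z^b$ induced by $A$. Fix a norm $\|\cdot\|$ on $\mathbb R^b$. We say that $o(\tilde x,\tilde f)$ globally shadows $o(\tilde y,A)$ if there is $K$ with $\|\tilde\iota\tilde f^n(\tilde x)-A^n\tilde y\|\le K$ for all $n\ge 0$. **Theorem [Franks, Shub, Band].** Suppose $f$ is $H_1$-expanding, i.e. all eigenvalues of $A$ lie outside the unit circle. Then: 1. $\tilde\iota\tilde f-A\tilde\iota$ descends to a continuous function $\sigma:M\to\mathbb R^b$, and for every $\tilde x\in\tilde M_a$, with $x=\pi(\tilde x)$, the limit $\tilde\beta(\tilde x)=\lim_{n\to\infty}A^{-n}\tilde\iota\tilde f^n(\tilde x)$ exists and equals $\tilde\iota(\tilde x)+\sum_{n\ge1}A^{-n}\sigma(f^{n-1}x)$. The map $\tilde\beta:\tilde M_a\to\mathbb R^b$ is continuous. 2. Let $\lambda>1$ be such that the spectral radius of $A^{-1}$ is less than $1/\lambda$. If $f$ is $L$-Lipschitz for the Riemannian distance of $M$, then $\tilde\beta$ is $\nu$-Hölder on bounded scales for every $0<\nu<\min(\log\lambda/\log L,\,1)$: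 for every $R$ there is $C$ with $\|\tilde\beta(\tilde x)-\tilde\beta(\tilde y)\|\le C\,d(\tilde x,\tilde y)^\nu$ whenever $d(\tilde x,\tilde y)\le R$, where $d$ is the distance on $\tilde M_a$ of the lifted Riemannian metric. 3. $\tilde\beta(\delta_{\vec n}\tilde x)=\tilde\beta(\tilde x)+\vec n$ for all $\vec n\in\mathbb Z^b$, and $\tilde\beta\circ\tilde f=A\circ\tilde\beta$. Hence $\tilde\beta$ descends to a continuous map $\beta:M\to\mathbb T^b$ with $\beta\circ f=\Phi_A\circ\beta$, a semiconjugacy of $f$ to $\Phi_A$ acting on the compact set $\beta(M)$, which satisfies $\Phi_A(\beta(M))\subset\beta(M)$, with equality if $f$ is onto. 4. $o(\tilde x,\tilde f)$ globally shadows $o(\tilde y,A)$ if and only if $\tilde y=\tilde\beta(\tilde x)$. Hence $\tilde\beta=\tilde\alpha$, where $\tilde\alpha(\tilde x)$ is the unique $\tilde y$ such that $o(\tilde x,\tilde f)$ globally shadows $o(\tilde y,A)$. -/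

import Mathlib

open CategoryTheory AlgebraicTopology Set Filter Topology Bundle Manifold
open scoped Simplicial ENNReal NNReal ContDiff Matrix

universe u v

noncomputable section

/-! ### First singular homology with integer coefficients -/

/-- The group of coefficients `ℤ`, lifted to the universe of the space. -/
abbrev intCoeff : ModuleCat.{u} ℤ := ModuleCat.of ℤ (ULift.{u} ℤ)

/-- The first singular homology `H₁(X; ℤ)`. -/
abbrev H1 (X : Type u) [TopologicalSpace X] : ModuleCat.{u} ℤ :=
  ((singularHomologyFunctor (ModuleCat.{u} ℤ) 1).obj intCoeff.{u}).obj (TopCat.of X)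

/-- The map `f_* : H₁(X; ℤ) → H₁(X; ℤ)` induced by `f`. -/
def H1map {X : Type u} [TopologicalSpace X] (f : C(X, X)) : H1 X →ₗ[ℤ] H1 X :=
  (((singularHomologyFunctor (ModuleCat.{u} ℤ) 1).obj intCoeff.{u}).map (TopCat.ofHom f)).hom

/-- A path as a singular 1-simplex, from the vertex `0` to the vertex `1`. -/
def pathSimplex {X : Type u} [TopologicalSpace X] {x y : X} (γ : Path x y) :
    (TopCat.toSSet.obj (TopCat.of X)) _⦋1⦌ :=
  ((TopCat.of X).toSSetObjEquiv (.op ⦋1⦌)).symm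
    (γ.toContinuousMap.comp (toContinuousMap stdSimplexHomeomorphUnitInterval))

/-- The two faces of the singular 1-simplex of a loop agree. -/
theorem pathSimplex_faces {X : Type u} [TopologicalSpace X] {x : X} (γ : Path x x) :
    (TopCat.toSSet.obj (TopCat.of X)).δ (0 : Fin 2) (pathSimplex γ) =
      (TopCat.toSSet.obj (TopCat.of X)).δ (1 : Fin 2) (pathSimplex γ) := by
  have key : ∀ (i : Fin 2) (s : stdSimplex ℝ (Fin 1)),
      (TopCat.of X).toSSetObjEquiv (.op ⦋0⦌)
        ((TopCat.toSSet.obj (TopCat.of X)).δ i (pathSimplex γ)) s = x := by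
    intro i s
    have h1 : (TopCat.of X).toSSetObjEquiv (.op ⦋0⦌)
        ((TopCat.toSSet.obj (TopCat.of X)).δ i (pathSimplex γ)) s =
        γ (stdSimplexHomeomorphUnitInterval (stdSimplex.map (Fin.succAbove i) s)) := rfl
    rw [h1, Subsingleton.elim s (stdSimplex.vertex 0), stdSimplex.map_vertex]
    fin_cases i
    · exact γ.target
    · exact γ.source
  apply ((TopCat.of X).toSSetObjEquiv (.op ⦋0⦌)).injective
  ext s
  exact (key 0 s).trans (key 1 s).symm

/-- The class in `H₁(X; ℤ)` of a loop: the class of the singular cycle given by the loop,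
with coefficient `1`. -/
def loopClass {X : Type u} [TopologicalSpace X] {x : X} (γ : Path x x) : H1 X :=
  let K := (TopCat.toSSet.obj (TopCat.of X)).chainComplex intCoeff.{u}
  (K.liftCycles ((TopCat.toSSet.obj (TopCat.of X)).ιChainComplex (pathSimplex γ)) 0
    (ChainComplex.next_nat_succ 0)
    (by simp [K, SSet.ιChainComplex_d, Fin.sum_univ_two, pathSimplex_faces]) ≫ K.homologyπ 1).hom (ULift.up 1)

/-! ### The universal Abelian cover -/

/-- `p : E → M` is a universal Abelian cover of `M`: a covering with path connected total space
such that the image of `π₁(E)` in `π₁(M)` is the commutator subgroup of `π₁(M)`; equivalently,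
`E` is the quotient of the universal cover by the commutator subgroup of the fundamental group. -/
structure IsUniversalAbelianCover {M : Type u} {E : Type v} [TopologicalSpace M]
    [TopologicalSpace E] (p : C(E, M)) : Prop where
  isCoveringMap : IsCoveringMap p
  pathConnectedSpace : PathConnectedSpace E
  range_map_eq : ∀ x : E,
    (FundamentalGroup.map p x).range = commutator (FundamentalGroup M (p x))

/-- `δ` is the deck transformation `δ_n` corresponding to `n ∈ ℤ^b`, with respect to a basis `Γ` of
`H₁(M; ℤ)`: it covers the identity, and every path from a point `x` to `δ x` projects to a loop
of homology class `∑ nᵢ Γᵢ`. -/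
def IsDeckTransformation {M : Type u} {E : Type v} [TopologicalSpace M] [TopologicalSpace E]
    {b : ℕ} (p : C(E, M)) (Γ : Module.Basis (Fin b) ℤ (H1 M)) (n : Fin b → ℤ) (δ : E ≃ₜ E) :
    Prop :=
  ∃ hδ : ∀ x, p (δ x) = p x, ∀ (x : E) (γ : Path x (δ x)),
    loopClass ((γ.map p.continuous).cast rfl (hδ x).symm) = ∑ i, n i • Γ i

/-! ### Closed one-forms and their integrals -/

section Forms

variable {d : ℕ} {M : Type u} [TopologicalSpace M] [ChartedSpace (EuclideanSpace ℝ (Fin d)) M]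

variable (d M) in
/-- (Not necessarily continuous) one-forms on a manifold `M` of dimension `d`. -/
abbrev OneForm : Type u := ∀ x : M, TangentSpace (𝓡 d) x →L[ℝ] ℝ

/-- The one-form `θ` read in the chart at `c`, i.e. its pullback under the inverse of the chart. -/
def OneForm.inChart (θ : OneForm d M) (c : M) (y : EuclideanSpace ℝ (Fin d)) :
    EuclideanSpace ℝ (Fin d) →L[ℝ] ℝ :=
  (θ ((chartAt (EuclideanSpace ℝ (Fin d)) c).symm y)).comp
    (mfderiv (𝓡 d) (𝓡 d) (chartAt (EuclideanSpace ℝ (Fin d)) c).symm y)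

/-- `θ` is a smooth closed one-form: in each chart it is smooth and `dθ = 0`. -/
structure OneForm.IsSmoothClosed (θ : OneForm d M) : Prop where
  smooth : ∀ c : M, ContDiffOn ℝ ∞ (θ.inChart c) (chartAt (EuclideanSpace ℝ (Fin d)) c).target
  closed : ∀ c : M, ∀ y ∈ (chartAt (EuclideanSpace ℝ (Fin d)) c).target,
    ∀ v w : EuclideanSpace ℝ (Fin d),
      fderiv ℝ (θ.inChart c) y v w - fderiv ℝ (θ.inChart c) y w v = 0

variable (d) in
/-- The curve `c`, restricted to `[0, 1]`, is smooth. -/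
def IsSmoothCurve (c : ℝ → M) : Prop := ContMDiffOn 𝓘(ℝ, ℝ) (𝓡 d) ∞ c (Icc 0 1)

/-- The integral of `θ` along the curve `c`, restricted to `[0, 1]`. -/
def OneForm.lineIntegral (θ : OneForm d M) (c : ℝ → M) : ℝ :=
  ∫ t in (0 : ℝ)..1, θ (c t) (mfderiv 𝓘(ℝ, ℝ) (𝓡 d) c t (1 : ℝ))

/-- The closed one-form `θ` takes the value `r` on the homology class `h`: it has integral `r`
along some (equivalently, any) smooth loop in the class `h`. -/
def OneForm.HasPeriod (θ : OneForm d M) (h : H1 M) (r : ℝ) : Prop :=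
  ∃ (x : M) (γ : Path x x), IsSmoothCurve d γ.extend ∧ loopClass γ = h ∧
    θ.lineIntegral γ.extend = r

variable {E : Type v} [TopologicalSpace E] {b : ℕ}

open Classical in
/-- The Abel-Jacobi-Albanese map `ι̃ : E → ℝ^b` with base point `x₀`: choose a path from `x₀` to
`x` in the cover which is smooth (that is, whose projection to `M` is smooth), and integrate
the lifts of the forms `θᵢ` along it (that is, the forms `θᵢ` along its projection). -/
def abelJacobi (p : C(E, M)) (θ : Fin b → OneForm d M) (x₀ x : E) : Fin b → ℝ :=
  if h : ∃ γ : Path x₀ x, IsSmoothCurve d (p ∘ γ.extend) then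
    fun i => (θ i).lineIntegral (p ∘ h.choose.extend)
  else 0

variable (d) in
/-- The distance on the cover `E` induced by the lift of the Riemannian metric of `M`: the infimum
of the lengths of (the projections of) the `C¹` paths in `E` from `x` to `y`. -/
def coverEDist [RiemannianBundle (fun x : M => TangentSpace (𝓡 d) x)] (p : C(E, M)) (x y : E) :
    ℝ≥0∞ :=
  ⨅ (γ : Path x y) (_ : ContMDiffOn 𝓘(ℝ, ℝ) (𝓡 d) 1 (p ∘ γ.extend) (Icc 0 1)),
    pathELength (𝓡 d) (p ∘ γ.extend) 0 1

end Forms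

/-! ### The action on first homology, toral endomorphisms, and shadowing -/

section Dynamics

variable {b : ℕ}

/-- The integer matrix of `f_* : H₁(M; ℤ) → H₁(M; ℤ)` in the basis `Γ`. -/
def homologyMatrix {M : Type u} [TopologicalSpace M] (Γ : Module.Basis (Fin b) ℤ (H1 M))
    (f : C(M, M)) : Matrix (Fin b) (Fin b) ℤ :=
  LinearMap.toMatrix Γ Γ (H1map f)

/-- The integer matrix `A`, with real entries. -/
abbrev realMatrix (A : Matrix (Fin b) (Fin b) ℤ) : Matrix (Fin b) (Fin b) ℝ :=
  A.map (Int.cast : ℤ → ℝ)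

/-- The integer matrix `A`, with complex entries. -/
abbrev complexMatrix (A : Matrix (Fin b) (Fin b) ℤ) : Matrix (Fin b) (Fin b) ℂ :=
  A.map (Int.cast : ℤ → ℂ)

/-- All (complex) eigenvalues of `A` are outside the unit circle. -/
def IsExpandingMatrix (A : Matrix (Fin b) (Fin b) ℤ) : Prop :=
  ∀ μ ∈ spectrum ℂ (complexMatrix A), 1 < ‖μ‖

/-- The projection `ℝ^b → 𝕋^b`. -/
def torusProj (v : Fin b → ℝ) : Fin b → UnitAddCircle := fun i => (v i : UnitAddCircle)

/-- The toral endomorphism `Φ_A : 𝕋^b → 𝕋^b`. -/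
def toralEndomorphism (A : Matrix (Fin b) (Fin b) ℤ) (y : Fin b → UnitAddCircle) :
    Fin b → UnitAddCircle := fun i => ∑ j, A i j • y j

variable {E : Type v}

/-- The orbits `o(x, F)` and `o(y, A)` globally shadow, with respect to the map `ι : E → ℝ^b` and
the norm `N` on `ℝ^b`. -/
def GloballyShadows (N : Seminorm ℝ (Fin b → ℝ)) (ι : E → Fin b → ℝ) (F : E → E)
    (A : Matrix (Fin b) (Fin b) ℝ) (x : E) (y : Fin b → ℝ) : Prop :=
  ∃ K : ℝ, ∀ n : ℕ, N (ι (F^[n] x) - (A ^ n) *ᵥ y) ≤ K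

open Classical in
/-- The map `α̃`: the unique `y` such that `o(x, F)` globally shadows `o(y, A)`. -/
def shadowingMap (N : Seminorm ℝ (Fin b → ℝ)) (ι : E → Fin b → ℝ) (F : E → E)
    (A : Matrix (Fin b) (Fin b) ℝ) (x : E) : Fin b → ℝ :=
  if h : ∃! y, GloballyShadows N ι F A x y then h.choose else 0

end Dynamics

end

/-!
Two points of `E` over the same point of `M` differ, under `ι̃`, by the integrals of the closed
forms over the homology class of the projection of a path joining them. Hence `σ = ι̃ F - A ι̃`
takes the same value at both points: the lift `F` acts on these classes by `f_*`, whose matrix is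
`A`. So `σ` lives on the compact space `M` and is bounded. Telescoping gives

  `A⁻ⁿ ι̃(Fⁿ x) = ι̃(x) + ∑_{k < n} A⁻⁽ᵏ⁺¹⁾ σ(fᵏ(p x))`,

which converges to `β̃(x)` at a geometric rate since the spectral radius of `A⁻¹` is less than
one. The maps `ι̃` and `σ` are Lipschitz when `f` is, so the `k`-th term of the series is
`ν`-Hölder with constant a multiple of `‖A⁻ᵏ‖ L^{νk}`, and these constants are summable when
`L^ν < λ`. The limit `β̃` satisfies `β̃ F = A β̃` and stays at bounded distance from `ι̃`, so
`o(x, F)` shadows the orbit of `β̃(x)`. It shadows no other one: if it shadows the orbit of `y`,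
then applying `A⁻ⁿ` to the bounded vectors `ι̃(Fⁿ x) - Aⁿ y` gives `β̃(x) = y` in the limit.

The covering theory enters through local primitives: a closed form is described by functions
defined on neighbourhoods of the points, whose differences are locally constant. These describe a
covering with discrete fibres, so that its integrals along maps from a simply connected space are
obtained by lifting, and integrating over singular simplices yields a homomorphism on `H₁(M; ℤ)`.
-/

noncomputable section

/-! ### Integration of locally defined primitives -/

instance : LocallyPathConnectedSpace unitInterval :=
  (convex_Icc (0 : ℝ) 1).locallyPathConnectedSpace

instance : ContractibleSpace unitInterval :=
  (convex_Icc (0 : ℝ) 1).contractibleSpace ⟨0, by simp⟩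

instance {n : ℕ} : LocallyPathConnectedSpace (stdSimplex ℝ (Fin (n + 1))) :=
  (convex_stdSimplex ℝ (Fin (n + 1))).locallyPathConnectedSpace

instance {n : ℕ} : ContractibleSpace (stdSimplex ℝ (Fin (n + 1))) :=
  (convex_stdSimplex ℝ (Fin (n + 1))).contractibleSpace ⟨_, single_mem_stdSimplex ℝ 0⟩

/-- A closed one-form on a topological space, presented by its local primitives: an open
neighbourhood `U i` of every point `i`, with a function `h i` on it, such that the differences
`h i - h j` are locally constant on the overlaps. -/
structure LocalPrimitives (X : Type*) [TopologicalSpace X] (V : Type*) [AddCommGroup V] where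
  U : X → Set X
  h : X → X → V
  isOpen_U : ∀ i, IsOpen (U i)
  mem_U : ∀ i, i ∈ U i
  compat : ∀ i j, ∀ x ∈ U i ∩ U j, ∀ᶠ y in 𝓝 x, h i y - h j y = h i x - h j x

namespace LocalPrimitives

variable {X : Type*} [TopologicalSpace X] {V : Type*} [AddCommGroup V] (P : LocalPrimitives X V)
  {Y Z Z' : Type*} [TopologicalSpace Y] [TopologicalSpace Z] [TopologicalSpace Z']

/-- `g` is a primitive of the pullback of the closed one-form along `c`: locally it differs by a
constant from the composition of a local primitive with `c`. -/
def IsPrimitiveAlong (c : Z → X) (g : Z → V) : Prop :=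
  ∀ z i, c z ∈ P.U i → ∀ᶠ z' in 𝓝 z, g z' - g z = P.h i (c z') - P.h i (c z)

variable {P}

theorem isPrimitiveAlong_of_exists {c : Z → X} {g : Z → V} (hc : Continuous c)
    (hg : ∀ z, ∃ i, c z ∈ P.U i ∧ ∀ᶠ z' in 𝓝 z, g z' - g z = P.h i (c z') - P.h i (c z)) :
    P.IsPrimitiveAlong c g := by
  intro z j hj
  obtain ⟨i, hi, hgi⟩ := hg z
  filter_upwards [hgi, hc.continuousAt.eventually (P.compat i j (c z) ⟨hi, hj⟩)] with z' h₁ h₂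
  rw [h₁, sub_eq_sub_iff_sub_eq_sub.1 h₂]

theorem isPrimitiveAlong_h_comp {c : Z → X} (hc : Continuous c) (i : X)
    (hi : ∀ z, c z ∈ P.U i) : P.IsPrimitiveAlong c fun z => P.h i (c z) :=
  isPrimitiveAlong_of_exists hc fun z => ⟨i, hi z, .of_forall fun _ => rfl⟩

namespace IsPrimitiveAlong

theorem comp {c : Z → X} {g : Z → V} (hg : P.IsPrimitiveAlong c g) {k : Z' → Z}
    (hk : Continuous k) : P.IsPrimitiveAlong (c ∘ k) (g ∘ k) :=
  fun z i hi => hk.continuousAt.eventually (hg (k z) i hi)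

theorem sub_eq_sub [PreconnectedSpace Z] {c : Z → X} {g g' : Z → V}
    (hg : P.IsPrimitiveAlong c g) (hg' : P.IsPrimitiveAlong c g') (z w : Z) :
    g z - g w = g' z - g' w := by
  have isLocallyConstant_sub : IsLocallyConstant fun z => g z - g' z := by
    refine (IsLocallyConstant.iff_eventually_eq _).2 fun z => ?_
    filter_upwards [hg z (c z) (P.mem_U _), hg' z (c z) (P.mem_U _)] with z' h₁ h₂
    exact sub_eq_sub_iff_sub_eq_sub.1 (h₁.trans h₂.symm)
  exact sub_eq_sub_iff_sub_eq_sub.1 (isLocallyConstant_sub.apply_eq_of_preconnectedSpace z w)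

end IsPrimitiveAlong

variable (P)

/-- The covering of `X` whose sections along a map are the primitives of the pullback of the closed
one-form along this map; its fibres are copies of the discrete group `V`. -/
def bundleCore [TopologicalSpace V] [DiscreteTopology V] : FiberBundleCore X X V where
  baseSet := P.U
  isOpen_baseSet := P.isOpen_U
  indexAt := id
  mem_baseSet_at := P.mem_U
  coordChange i j x v := v + (P.h i x - P.h j x)
  coordChange_self i x _ v := by simp
  continuousOn_coordChange i j := by
    rintro ⟨x, v⟩ ⟨hx, -⟩
    have eventually_sub_eq : ∀ᶠ q : X × V in 𝓝 (x, v),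
        P.h i q.1 - P.h j q.1 = P.h i x - P.h j x :=
      (continuous_fst.tendsto (x, v)).eventually (P.compat i j x hx)
    have : ContinuousAt (fun q : X × V => q.2 + (P.h i x - P.h j x)) (x, v) := by fun_prop
    refine (this.congr ?_).continuousWithinAt
    filter_upwards [eventually_sub_eq] with q hq
    rw [hq]
  coordChange_comp i j k x _ v := by abel

theorem exists_isPrimitiveAlong [SimplyConnectedSpace Z] [LocallyPathConnectedSpace Z]
    (c : C(Z, X)) : ∃ g : Z → V, P.IsPrimitiveAlong c g := by
  let : TopologicalSpace V := ⊥
  have : DiscreteTopology V := ⟨rfl⟩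
  let B := P.bundleCore
  have isCoveringMap_proj : IsCoveringMap (TotalSpace.proj : TotalSpace V B.Fiber → X) :=
    FiberBundle.isCoveringMap
  obtain ⟨z₀⟩ : Nonempty Z := inferInstance
  obtain ⟨s, ⟨-, hs⟩, -⟩ := isCoveringMap_proj.existsUnique_continuousMap_lifts c z₀
    (⟨c z₀, (0 : V)⟩ : TotalSpace V B.Fiber) rfl
  have proj_s (z : Z) : (s z).proj = c z := congrFun hs z
  let w : Z → V := fun z => (s z).snd
  refine ⟨fun z => w z + P.h (c z) (c z), fun z i hi => ?_⟩
  have localTriv_s (z : Z) : ((B.localTriv i) (s z)).2 =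
      w z + (P.h (c z) (c z) - P.h i (c z)) := by
    rw [← proj_s z]
    rfl
  have mem_source : s z ∈ (B.localTriv i).source := by
    rw [FiberBundleCore.mem_localTriv_source]
    exact (proj_s z).symm ▸ hi
  have eventually_eq : ∀ᶠ z' in 𝓝 z, ((B.localTriv i) (s z')).2 = ((B.localTriv i) (s z)).2 :=
    (continuous_snd.continuousAt.comp
      (((B.localTriv i).continuousAt mem_source).comp s.continuous.continuousAt)).eventually
      (eventually_of_mem (by simp [nhds_discrete]) fun _ => mem_singleton_iff.1)
  filter_upwards [eventually_eq] with z' hz'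
  rw [localTriv_s, localTriv_s, ← add_sub_assoc, ← add_sub_assoc] at hz'
  exact sub_eq_sub_iff_sub_eq_sub.1 hz'

/-- The integral of the closed one-form along `c`, from `z` to `w`. As `Z` is simply connected, it
does not depend on a path from `z` to `w`. -/
def integralAlong [SimplyConnectedSpace Z] [LocallyPathConnectedSpace Z] (c : C(Z, X))
    (z w : Z) : V :=
  (P.exists_isPrimitiveAlong c).choose w - (P.exists_isPrimitiveAlong c).choose z

/-- The integral of the closed one-form along a path. -/
def pathIntegral {x y : X} (γ : Path x y) : V :=
  P.integralAlong γ.toContinuousMap 0 1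

section integralAlong

variable [SimplyConnectedSpace Z] [LocallyPathConnectedSpace Z] {P}

theorem IsPrimitiveAlong.integralAlong_eq {c : C(Z, X)} {g : Z → V}
    (hg : P.IsPrimitiveAlong c g) (z w : Z) : P.integralAlong c z w = g w - g z :=
  (P.exists_isPrimitiveAlong c).choose_spec.sub_eq_sub hg w z

theorem IsPrimitiveAlong.pathIntegral_eq {x y : X} {γ : Path x y} {g : unitInterval → V}
    (hg : P.IsPrimitiveAlong γ g) : P.pathIntegral γ = g 1 - g 0 :=
  IsPrimitiveAlong.integralAlong_eq (c := γ.toContinuousMap) hg 0 1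

variable (P)

theorem integralAlong_comp [SimplyConnectedSpace Z'] [LocallyPathConnectedSpace Z'] (c : C(Z, X))
    (k : C(Z', Z)) (z w : Z') : P.integralAlong (c.comp k) z w = P.integralAlong c (k z) (k w) :=
  ((P.exists_isPrimitiveAlong c).choose_spec.comp k.continuous).integralAlong_eq
    (c := c.comp k) z w

theorem integralAlong_add_integralAlong (c : C(Z, X)) (z y w : Z) :
    P.integralAlong c z y + P.integralAlong c y w = P.integralAlong c z w := by
  simp only [integralAlong]
  abel

theorem integralAlong_const (a : X) (z w : Z) :
    P.integralAlong (ContinuousMap.const Z a) z w = 0 := by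
  rw [(isPrimitiveAlong_h_comp (P := P) (ContinuousMap.const Z a).continuous a
    fun _ => P.mem_U a).integralAlong_eq z w]
  exact sub_self _

end integralAlong

variable {P}

theorem IsPrimitiveAlong.pathIntegral_map {c : C(Z, X)} {g : Z → V}
    (hg : P.IsPrimitiveAlong c g) {z w : Z} (γ : Path z w) :
    P.pathIntegral (γ.map c.continuous) = g w - g z := by
  have : P.IsPrimitiveAlong (γ.map c.continuous) (g ∘ γ) := hg.comp γ.continuous
  simpa using this.pathIntegral_eq

variable (P)

theorem pathIntegral_cast {x y x' y' : X} (γ : Path x y) (hx : x' = x) (hy : y' = y) :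
    P.pathIntegral (γ.cast hx hy) = P.pathIntegral γ := by
  subst hx hy
  rfl

theorem pathIntegral_trans {x y z : X} (γ : Path x y) (γ' : Path y z) :
    P.pathIntegral (γ.trans γ') = P.pathIntegral γ + P.pathIntegral γ' := by
  let left : C(unitInterval, unitInterval) :=
    ⟨fun t => ⟨t / 2, by linarith [t.2.1], by linarith [t.2.2]⟩, by fun_prop⟩
  let right : C(unitInterval, unitInterval) :=
    ⟨fun t => ⟨(t + 1) / 2, by linarith [t.2.1], by linarith [t.2.2]⟩, by fun_prop⟩
  have comp_left : (γ.trans γ').toContinuousMap.comp left = γ.toContinuousMap := by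
    ext t
    have : (t : ℝ) / 2 ≤ 1 / 2 := by linarith [t.2.2]
    simp only [ContinuousMap.comp_apply, Path.coe_toContinuousMap, ContinuousMap.coe_mk, left,
      Path.trans_apply, dif_pos this, mul_div_cancel₀ (t : ℝ) two_ne_zero]
  have comp_right : (γ.trans γ').toContinuousMap.comp right = γ'.toContinuousMap := by
    ext t
    rcases eq_or_lt_of_le t.2.1 with h | h
    · obtain rfl : t = 0 := Subtype.ext h.symm
      simp [Path.trans, right]
    · have : ¬ ((t : ℝ) + 1) / 2 ≤ 1 / 2 := by linarith
      simp only [ContinuousMap.comp_apply, Path.coe_toContinuousMap, ContinuousMap.coe_mk, right,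
        Path.trans_apply, dif_neg this, mul_div_cancel₀ ((t : ℝ) + 1) two_ne_zero,
        add_sub_cancel_right]
  have left_zero : left 0 = 0 := Subtype.ext (by simp [left])
  have left_one : left 1 = right 0 := Subtype.ext (by simp [left, right])
  have right_one : right 1 = 1 := Subtype.ext (by simp [right])
  calc P.pathIntegral (γ.trans γ')
      = P.integralAlong (γ.trans γ').toContinuousMap (left 0) (left 1) +
          P.integralAlong (γ.trans γ').toContinuousMap (right 0) (right 1) := by
        rw [left_zero, left_one, right_one, integralAlong_add_integralAlong]
        rfl
    _ = P.pathIntegral γ + P.pathIntegral γ' := by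
        rw [← integralAlong_comp, ← integralAlong_comp, comp_left, comp_right]
        rfl

theorem pathIntegral_symm {x y : X} (γ : Path x y) :
    P.pathIntegral γ.symm = -P.pathIntegral γ := by
  have comp_symm : γ.symm.toContinuousMap =
      γ.toContinuousMap.comp ⟨unitInterval.symm, unitInterval.continuous_symm⟩ := rfl
  rw [pathIntegral, comp_symm, integralAlong_comp]
  simp [pathIntegral, integralAlong]

theorem pathIntegral_eq_of_homotopic {x y : X} {γ γ' : Path x y} (hγ : γ.Homotopic γ') :
    P.pathIntegral γ = P.pathIntegral γ' := by
  obtain ⟨H⟩ := hγ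
  have integral_bottom : P.integralAlong H.toContinuousMap (0, 0) (0, 1) = P.pathIntegral γ :=
    (P.integralAlong_comp H.toContinuousMap ⟨fun t => (0, t), by fun_prop⟩ 0 1).symm.trans
      (congrArg (P.integralAlong · 0 1) (by ext t; exact H.apply_zero t))
  have integral_top : P.integralAlong H.toContinuousMap (1, 0) (1, 1) = P.pathIntegral γ' :=
    (P.integralAlong_comp H.toContinuousMap ⟨fun t => (1, t), by fun_prop⟩ 0 1).symm.trans
      (congrArg (P.integralAlong · 0 1) (by ext t; exact H.apply_one t))
  have integral_left : P.integralAlong H.toContinuousMap (0, 0) (1, 0) = 0 :=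
    (P.integralAlong_comp H.toContinuousMap ⟨fun s => (s, 0), by fun_prop⟩ 0 1).symm.trans
      ((congrArg (P.integralAlong · 0 1) (by ext s; exact H.source s)).trans
        (P.integralAlong_const x 0 1))
  have integral_right : P.integralAlong H.toContinuousMap (0, 1) (1, 1) = 0 :=
    (P.integralAlong_comp H.toContinuousMap ⟨fun s => (s, 1), by fun_prop⟩ 0 1).symm.trans
      ((congrArg (P.integralAlong · 0 1) (by ext s; exact H.target s)).trans
        (P.integralAlong_const y 0 1))
  have integral_diagonal := (P.integralAlong_add_integralAlong H.toContinuousMap (0, 0) (0, 1)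
    (1, 1)).trans (P.integralAlong_add_integralAlong H.toContinuousMap (0, 0) (1, 0) (1, 1)).symm
  rwa [integral_bottom, integral_right, integral_left, integral_top, add_zero, zero_add]
    at integral_diagonal

/-- The periods of the closed one-form, as a homomorphism on the fundamental group. -/
def fundamentalGroupHom (x : X) : FundamentalGroup X x →* Multiplicative V :=
  MonoidHom.mk' (fun γ => Multiplicative.ofAdd
    (Quotient.lift (fun γ : Path x x => P.pathIntegral γ)
      (fun _ _ h => P.pathIntegral_eq_of_homotopic h) γ)) <| by
    rintro ⟨γ⟩ ⟨γ'⟩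
    rw [mul_comm, ← ofAdd_add]
    exact congrArg Multiplicative.ofAdd (P.pathIntegral_trans γ' γ)

theorem pathIntegral_map_eq_zero {p : C(Y, X)} {y : Y}
    (hp : (FundamentalGroup.map p y).range ≤ commutator (FundamentalGroup X (p y)))
    (γ : Path y y) : P.pathIntegral (γ.map p.continuous) = 0 := by
  have mem_ker : FundamentalGroup.map p y (FundamentalGroup.fromPath (.mk γ)) ∈
      (P.fundamentalGroupHom (p y)).ker :=
    Abelianization.commutator_subset_ker _ (hp ⟨_, rfl⟩)
  exact Multiplicative.ofAdd.injective (MonoidHom.mem_ker.1 mem_ker)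

theorem pathIntegral_map_eq_of_range_le {p : C(Y, X)} {y z : Y}
    (hp : (FundamentalGroup.map p y).range ≤ commutator (FundamentalGroup X (p y)))
    (γ γ' : Path y z) :
    P.pathIntegral (γ.map p.continuous) = P.pathIntegral (γ'.map p.continuous) := by
  have := P.pathIntegral_map_eq_zero hp (γ.trans γ'.symm)
  rwa [Path.map_trans, pathIntegral_trans, ← Path.map_symm, pathIntegral_symm,
    ← sub_eq_add_neg, sub_eq_zero] at this

theorem exists_isPrimitiveAlong_of_range_le [PathConnectedSpace Y] [LocallyPathConnectedSpace Y]
    (p : C(Y, X))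
    (hp : ∀ y, (FundamentalGroup.map p y).range ≤ commutator (FundamentalGroup X (p y))) :
    ∃ g : Y → V, P.IsPrimitiveAlong p g := by
  obtain ⟨y₀⟩ : Nonempty Y := inferInstance
  let path : ∀ y, Path y₀ y := fun y => PathConnectedSpace.somePath y₀ y
  refine ⟨fun y => P.pathIntegral ((path y).map p.continuous), isPrimitiveAlong_of_exists
    p.continuous fun y => ⟨p y, P.mem_U _, ?_⟩⟩
  obtain ⟨W, ⟨hW, hWc⟩, hWU⟩ := (path_connected_basis y).mem_iff.1
    (((P.isOpen_U (p y)).preimage p.continuous).mem_nhds (P.mem_U _))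
  filter_upwards [hW] with z hz
  obtain ⟨γ, hγ⟩ := hWc.joinedIn y (mem_of_mem_nhds hW) z hz
  have integral_γ : P.pathIntegral (γ.map p.continuous) = P.h (p y) (p z) - P.h (p y) (p y) := by
    simpa using (isPrimitiveAlong_h_comp (P := P) (γ.map p.continuous).continuous (p y)
      fun t => hWU (hγ t)).pathIntegral_eq
  rw [P.pathIntegral_map_eq_of_range_le (hp y₀) (path z) ((path y).trans γ), Path.map_trans,
    pathIntegral_trans, integral_γ, add_sub_cancel_left]

end LocalPrimitives

/-! ### Integration over homology classes -/

section Homology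

variable {X : Type u} [TopologicalSpace X]

theorem intCoeff_hom_ext {W : ModuleCat.{u} ℤ} {φ ψ : intCoeff.{u} ⟶ W}
    (h : φ.hom (ULift.up 1) = ψ.hom (ULift.up 1)) : φ = ψ := by
  ext ⟨n⟩
  have : (ULift.up n : ULift.{u} ℤ) = n • ULift.up 1 := by ext; simp
  rw [this, map_zsmul, map_zsmul, h]

theorem loopClass_cast {x y : X} (γ : Path x x) (h : y = x) :
    loopClass (γ.cast h h) = loopClass γ := by
  subst h
  rfl

theorem loopClass_map (f : C(X, X)) {x : X} (γ : Path x x) :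
    loopClass (γ.map f.continuous) = H1map f (loopClass γ) := by
  let S := TopCat.toSSet.obj (TopCat.of X)
  let K := S.chainComplex intCoeff.{u}
  let F : S ⟶ S := TopCat.toSSet.map (TopCat.ofHom f)
  have naturality : ∀ (h₀ : _ = _) (h : _ = _) (h' : _ = _),
      (K.liftCycles (S.ιChainComplex (pathSimplex γ)) 0 h₀ h ≫ K.homologyπ 1) ≫
        HomologicalComplex.homologyMap (SSet.chainComplexMap F intCoeff.{u}) 1 =
      K.liftCycles (S.ιChainComplex (pathSimplex (γ.map f.continuous))) 0 h₀ h' ≫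
        K.homologyπ 1 := by
    intro h₀ h h'
    rw [Category.assoc, HomologicalComplex.homologyπ_naturality, ← Category.assoc]
    congr 1
    rw [HomologicalComplex.liftCycles_comp_cyclesMap]
    congr 1
    exact SSet.ι_chainComplexMap_f _ _ F _ _
  exact (congrArg (fun φ => φ.hom (ULift.up 1)) (naturality _ _ _)).symm

namespace LocalPrimitives

variable {V : Type} [AddCommGroup V] (P : LocalPrimitives X V)

/-- The integral of the closed one-form over a singular 1-simplex. -/
def simplexIntegral (s : (TopCat.toSSet.obj (TopCat.of X)) _⦋1⦌) : V :=
  P.integralAlong ((TopCat.of X).toSSetObjEquiv (.op ⦋1⦌) s)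
    (stdSimplex.vertex 0 : stdSimplex ℝ (Fin 2)) (stdSimplex.vertex 1 : stdSimplex ℝ (Fin 2))

theorem simplexIntegral_pathSimplex {x y : X} (γ : Path x y) :
    P.simplexIntegral (pathSimplex γ) = P.pathIntegral γ := by
  refine (P.integralAlong_comp γ.toContinuousMap
    (toContinuousMap stdSimplexHomeomorphUnitInterval) _ _).trans ?_
  exact congrArg₂ (P.integralAlong γ.toContinuousMap) stdSimplexHomeomorphUnitInterval_zero
    stdSimplexHomeomorphUnitInterval_one

theorem simplexIntegral_δ (s : (TopCat.toSSet.obj (TopCat.of X)) _⦋2⦌) (i : Fin 3) :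
    P.simplexIntegral ((TopCat.toSSet.obj (TopCat.of X)).δ i s) =
      P.integralAlong ((TopCat.of X).toSSetObjEquiv (.op ⦋2⦌) s)
        (stdSimplex.vertex (i.succAbove 0) : stdSimplex ℝ (Fin 3))
        (stdSimplex.vertex (i.succAbove 1) : stdSimplex ℝ (Fin 3)) := by
  refine (P.integralAlong_comp ((TopCat.of X).toSSetObjEquiv (.op ⦋2⦌) s)
    ⟨_, stdSimplex.continuous_map i.succAbove⟩ _ _).trans ?_
  exact congrArg₂ (P.integralAlong ((TopCat.of X).toSSetObjEquiv (.op ⦋2⦌) s))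
    (stdSimplex.map_vertex _ _) (stdSimplex.map_vertex _ _)

theorem sum_simplexIntegral_δ (s : (TopCat.toSSet.obj (TopCat.of X)) _⦋2⦌) :
    ∑ i : Fin 3, (-1 : ℤ) ^ (i : ℕ) •
      P.simplexIntegral ((TopCat.toSSet.obj (TopCat.of X)).δ i s) = 0 := by
  have triangle := P.integralAlong_add_integralAlong ((TopCat.of X).toSSetObjEquiv (.op ⦋2⦌) s)
    (stdSimplex.vertex 0 : stdSimplex ℝ (Fin 3)) (stdSimplex.vertex 1 : stdSimplex ℝ (Fin 3))
    (stdSimplex.vertex 2 : stdSimplex ℝ (Fin 3))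
  have succAbove_eq : (0 : Fin 3).succAbove 0 = 1 ∧ (0 : Fin 3).succAbove 1 = 2 ∧
      (1 : Fin 3).succAbove 0 = 0 ∧ (1 : Fin 3).succAbove 1 = 2 ∧
      (2 : Fin 3).succAbove 0 = 0 ∧ (2 : Fin 3).succAbove 1 = 1 := by decide
  simp only [Fin.sum_univ_three, simplexIntegral_δ, succAbove_eq, ← triangle, Fin.val_zero,
    Fin.val_one, Fin.val_two, pow_zero, pow_one, one_smul, neg_smul, neg_one_sq]
  abel

/-- The coefficient map sending `1` to `r`. -/
def coeffHom (r : V) : intCoeff.{u} ⟶ ModuleCat.of ℤ (ULift.{u} V) :=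
  ModuleCat.ofHom
    ((LinearMap.toSpanSingleton ℤ (ULift.{u} V) (ULift.up r)).comp ULift.moduleEquiv.toLinearMap)

theorem coeffHom_up_one (r : V) : (coeffHom.{u} r).hom (ULift.up 1) = ULift.up r := by
  simp [coeffHom]

/-- The singular 1-cochain given by integrating the closed one-form. -/
def cochain : ((TopCat.toSSet.obj (TopCat.of X)).chainComplex intCoeff.{u}).X 1 ⟶
    ModuleCat.of ℤ (ULift.{u} V) :=
  Limits.Cofan.IsColimit.desc ((TopCat.toSSet.obj (TopCat.of X)).isColimitChainComplexXCofan _ 1)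
    fun s => coeffHom (P.simplexIntegral s)

theorem ιChainComplex_cochain (s : (TopCat.toSSet.obj (TopCat.of X)) _⦋1⦌) :
    (TopCat.toSSet.obj (TopCat.of X)).ιChainComplex s ≫ P.cochain =
      coeffHom (P.simplexIntegral s) :=
  Limits.Cofan.IsColimit.fac
    ((TopCat.toSSet.obj (TopCat.of X)).isColimitChainComplexXCofan intCoeff.{u} 1) _ s

theorem d_comp_cochain :
    ((TopCat.toSSet.obj (TopCat.of X)).chainComplex intCoeff.{u}).d 2 1 ≫ P.cochain = 0 := by
  refine SSet.chainComplex_hom_ext fun s => intCoeff_hom_ext ?_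
  rw [SSet.ιChainComplex_d_assoc, Limits.comp_zero, Preadditive.sum_comp]
  simp only [Preadditive.zsmul_comp, ιChainComplex_cochain, ModuleCat.hom_sum,
    ModuleCat.hom_zsmul, LinearMap.sum_apply, LinearMap.smul_apply]
  refine (Finset.sum_congr rfl fun i _ => congrArg (_ • ·) (coeffHom_up_one _)).trans ?_
  exact (map_sum (ULift.moduleEquiv (R := ℤ) (M := V)).symm _ _).symm.trans
    (congrArg ULift.up (P.sum_simplexIntegral_δ s))

/-- The integral of the closed one-form over first homology classes. -/
def homologyIntegral : H1 X →ₗ[ℤ] V :=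
  ULift.moduleEquiv.toLinearMap ∘ₗ
    (((TopCat.toSSet.obj (TopCat.of X)).chainComplex intCoeff.{u}).homologyι 1 ≫
      ((TopCat.toSSet.obj (TopCat.of X)).chainComplex intCoeff.{u}).descOpcycles P.cochain 2
        (by simp) P.d_comp_cochain).hom

theorem homologyIntegral_loopClass {x : X} (γ : Path x x) :
    P.homologyIntegral (loopClass γ) = P.pathIntegral γ := by
  let K := (TopCat.toSSet.obj (TopCat.of X)).chainComplex intCoeff.{u}
  have lift_desc : ∀ (h₀ : _ = _) (h : _ = _),
      (K.liftCycles ((TopCat.toSSet.obj (TopCat.of X)).ιChainComplex (pathSimplex γ)) 0 h₀ h ≫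
        K.homologyπ 1) ≫ (K.homologyι 1 ≫ K.descOpcycles P.cochain 2 (by simp) P.d_comp_cochain) =
      coeffHom (P.simplexIntegral (pathSimplex γ)) := by
    intro h₀ h
    rw [Category.assoc, HomologicalComplex.homology_π_ι_assoc,
      HomologicalComplex.liftCycles_i_assoc, HomologicalComplex.p_descOpcycles,
      ιChainComplex_cochain]
  rw [← simplexIntegral_pathSimplex]
  exact congrArg ULift.down ((congrArg (fun φ => φ.hom (ULift.up 1)) (lift_desc _ _)).trans
    (coeffHom_up_one _))

end LocalPrimitives

end Homology

/-! ### Local primitives of smooth closed one-forms -/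

theorem LocalPrimitives.IsPrimitiveAlong.eventually_IccExtend_eq {X : Type*} [TopologicalSpace X]
    {V : Type*} [AddCommGroup V] {P : LocalPrimitives X V} {c : ℝ → X} {g : unitInterval → V}
    (hg : P.IsPrimitiveAlong (fun t : unitInterval => c t) g) {t : ℝ} (ht : t ∈ Icc (0 : ℝ) 1)
    {m : X} (hm : c t ∈ P.U m) :
    ∀ᶠ s in 𝓝[Icc 0 1] t, IccExtend zero_le_one g s =
      P.h m (c s) + (IccExtend zero_le_one g t - P.h m (c t)) := by
  refine (eventually_nhds_subtype_iff (Icc (0 : ℝ) 1) ⟨t, ht⟩ fun s =>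
    IccExtend zero_le_one g s = P.h m (c s) + (IccExtend zero_le_one g t - P.h m (c t))).1 ?_
  filter_upwards [hg ⟨t, ht⟩ m hm] with s hs
  rw [IccExtend_val, IccExtend_of_mem _ _ ht, sub_eq_iff_eq_add.1 hs, sub_add_eq_add_sub,
    add_sub_assoc]

section Manifold

variable {d : ℕ} {M : Type u} [TopologicalSpace M] [ChartedSpace (EuclideanSpace ℝ (Fin d)) M]

/-- The local primitives `P` are smooth with differential `θ`. -/
structure LocalPrimitives.IsPrimitiveOf (P : LocalPrimitives M ℝ) (θ : OneForm d M) : Prop where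
  contMDiffOn : ∀ m, ContMDiffOn (𝓡 d) 𝓘(ℝ, ℝ) ∞ (P.h m) (P.U m)
  hasMFDerivAt : ∀ m, ∀ y ∈ P.U m, HasMFDerivAt (𝓡 d) 𝓘(ℝ, ℝ) (P.h m) y (θ y)

theorem OneForm.IsSmoothClosed.exists_primitive_inChart {θ : OneForm d M} (hθ : θ.IsSmoothClosed)
    (c : M) : ∃ r > 0, ∃ ψ : EuclideanSpace ℝ (Fin d) → ℝ,
      ContDiffOn ℝ ∞ ψ (Metric.ball (chartAt (EuclideanSpace ℝ (Fin d)) c c) r) ∧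
      ∀ y ∈ Metric.ball (chartAt (EuclideanSpace ℝ (Fin d)) c c) r,
        HasFDerivAt ψ (θ.inChart c y) y := by
  set e := chartAt (EuclideanSpace ℝ (Fin d)) c
  obtain ⟨r, hr, hball⟩ := Metric.isOpen_iff.1 e.open_target (e c)
    (e.map_source (mem_chart_source _ c))
  have hsm := (hθ.smooth c).mono hball
  obtain ⟨ψ, hψ⟩ := (convex_ball (e c) r).exists_forall_hasFDerivAt_of_fderiv_symmetric
    Metric.isOpen_ball (hsm.differentiableOn (by simp))
    (fun a ha x y => sub_eq_zero.1 (hθ.closed c a (hball ha) x y))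
  refine ⟨r, hr, ψ, ?_, hψ⟩
  rw [contDiffOn_infty_iff_fderiv_of_isOpen Metric.isOpen_ball]
  exact ⟨fun y hy => (hψ y hy).differentiableAt.differentiableWithinAt,
    hsm.congr fun y hy => (hψ y hy).fderiv⟩

namespace LocalPrimitives.IsPrimitiveOf

variable {P : LocalPrimitives M ℝ} {θ : OneForm d M} {c : ℝ → M} {g : unitInterval → ℝ}

theorem contDiffOn_IccExtend (hP : P.IsPrimitiveOf θ)
    (hc : ContMDiffOn 𝓘(ℝ, ℝ) (𝓡 d) 1 c (Icc 0 1))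
    (hg : P.IsPrimitiveAlong (fun t : unitInterval => c t) g) :
    ContDiffOn ℝ 1 (IccExtend zero_le_one g) (Icc 0 1) := by
  intro t ht
  have hm := P.mem_U (c t)
  have contMDiffWithinAt_h_comp :
      ContMDiffWithinAt 𝓘(ℝ, ℝ) 𝓘(ℝ, ℝ) 1 (P.h (c t) ∘ c) (Icc 0 1) t :=
    (((hP.contMDiffOn (c t)).contMDiffAt ((P.isOpen_U _).mem_nhds hm)).of_le
      (by simp)).comp_contMDiffWithinAt t (hc t ht)
  exact contMDiffWithinAt_iff_contDiffWithinAt.1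
    ((contMDiffWithinAt_h_comp.add contMDiffWithinAt_const).congr_of_eventuallyEq
      (hg.eventually_IccExtend_eq ht hm) (by simp))

theorem derivWithin_IccExtend (hP : P.IsPrimitiveOf θ)
    (hc : ContMDiffOn 𝓘(ℝ, ℝ) (𝓡 d) 1 c (Icc 0 1))
    (hg : P.IsPrimitiveAlong (fun t : unitInterval => c t) g) {t : ℝ} (ht : t ∈ Icc (0 : ℝ) 1) :
    derivWithin (IccExtend zero_le_one g) (Icc 0 1) t =
      θ (c t) (mfderivWithin 𝓘(ℝ, ℝ) (𝓡 d) c (Icc 0 1) t (1 : ℝ)) := by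
  have hm := P.mem_U (c t)
  have hasFDerivWithinAt_h_comp : HasFDerivWithinAt (P.h (c t) ∘ c)
      (ContinuousLinearMap.comp (θ (c t) : EuclideanSpace ℝ (Fin d) →L[ℝ] ℝ)
        (mfderivWithin 𝓘(ℝ, ℝ) (𝓡 d) c (Icc 0 1) t : ℝ →L[ℝ] EuclideanSpace ℝ (Fin d)))
      (Icc 0 1) t :=
    hasMFDerivWithinAt_iff_hasFDerivWithinAt.1 <|
      (hP.hasMFDerivAt (c t) (c t) hm).comp_hasMFDerivWithinAt t
        ((hc t ht).mdifferentiableWithinAt one_ne_zero).hasMFDerivWithinAt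
  have hasDerivWithinAt_IccExtend :=
    (hasFDerivWithinAt_h_comp.hasDerivWithinAt.add_const _).congr_of_eventuallyEq
      (hg.eventually_IccExtend_eq ht hm) (by simp)
  exact hasDerivWithinAt_IccExtend.derivWithin (uniqueDiffOn_Icc zero_lt_one t ht)

theorem lineIntegral_eq (hP : P.IsPrimitiveOf θ)
    (hc : ContMDiffOn 𝓘(ℝ, ℝ) (𝓡 d) 1 c (Icc 0 1))
    (hg : P.IsPrimitiveAlong (fun t : unitInterval => c t) g) :
    θ.lineIntegral c = g 1 - g 0 := by
  calc θ.lineIntegral c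
      = ∫ t in (0 : ℝ)..1, derivWithin (IccExtend zero_le_one g) (Icc 0 1) t := by
        refine intervalIntegral.integral_congr_uIoo fun t ht => ?_
        rw [uIoo_of_le zero_le_one] at ht
        rw [hP.derivWithin_IccExtend hc hg (Ioo_subset_Icc_self ht),
          mfderivWithin_of_mem_nhds (Icc_mem_nhds ht.1 ht.2)]
    _ = g 1 - g 0 := by
        rw [intervalIntegral.integral_derivWithin_Icc_of_contDiffOn_Icc
          (hP.contDiffOn_IccExtend hc hg) zero_le_one, IccExtend_right, IccExtend_left]
        rfl

theorem enorm_sub_le_mul_pathELength [∀ y : M, ENorm (TangentSpace (𝓡 d) y)] {K : ℝ≥0}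
    (hK : ∀ (y : M) (v : TangentSpace (𝓡 d) y), ‖θ y v‖ₑ ≤ K * ‖v‖ₑ) (hP : P.IsPrimitiveOf θ)
    (hc : ContMDiffOn 𝓘(ℝ, ℝ) (𝓡 d) 1 c (Icc 0 1))
    (hg : P.IsPrimitiveAlong (fun t : unitInterval => c t) g) :
    ‖g 1 - g 0‖ₑ ≤ K * pathELength (𝓡 d) c 0 1 := by
  calc ‖g 1 - g 0‖ₑ
      = ‖IccExtend zero_le_one g 1 - IccExtend zero_le_one g 0‖ₑ := by
        rw [IccExtend_right, IccExtend_left]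
        rfl
    _ ≤ ∫⁻ t in Icc (0 : ℝ) 1, ‖derivWithin (IccExtend zero_le_one g) (Icc 0 1) t‖ₑ :=
        enorm_sub_le_lintegral_derivWithin_Icc_of_contDiffOn_Icc
          (hP.contDiffOn_IccExtend hc hg) zero_le_one
    _ ≤ ∫⁻ t in Icc (0 : ℝ) 1,
          K * ‖mfderivWithin 𝓘(ℝ, ℝ) (𝓡 d) c (Icc 0 1) t (1 : ℝ)‖ₑ := by
        refine MeasureTheory.setLIntegral_mono' measurableSet_Icc fun t ht => ?_
        rw [hP.derivWithin_IccExtend hc hg ht]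
        exact hK _ _
    _ = K * pathELength (𝓡 d) c 0 1 := by
        rw [MeasureTheory.lintegral_const_mul' _ _ ENNReal.coe_ne_top,
          pathELength_eq_lintegral_mfderivWithin_Icc]
        rfl

theorem continuous_of_isPrimitiveAlong (hP : P.IsPrimitiveOf θ) {Z : Type*} [TopologicalSpace Z]
    {c : Z → M} (hc : Continuous c) {g : Z → ℝ} (hg : P.IsPrimitiveAlong c g) : Continuous g := by
  refine continuous_iff_continuousAt.2 fun z => ?_
  have hz := P.mem_U (c z)
  have continuousAt_h : ContinuousAt (P.h (c z)) (c z) :=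
    (hP.contMDiffOn (c z)).continuousOn.continuousAt ((P.isOpen_U _).mem_nhds hz)
  refine ((continuousAt_h.comp hc.continuousAt).add
    (continuousAt_const (y := g z - P.h (c z) (c z)))).congr ?_
  filter_upwards [hg z (c z) hz] with w hw
  rw [Pi.add_apply, Function.comp_apply]
  linarith

end LocalPrimitives.IsPrimitiveOf

section IsManifold

variable [IsManifold (𝓡 d) ∞ M]

theorem OneForm.inChart_comp_mfderiv (θ : OneForm d M) (c : M) {y : M}
    (hy : y ∈ (chartAt (EuclideanSpace ℝ (Fin d)) c).source) :
    (θ.inChart c (chartAt (EuclideanSpace ℝ (Fin d)) c y)).comp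
      (mfderiv (𝓡 d) (𝓡 d) (chartAt (EuclideanSpace ℝ (Fin d)) c) y) = θ y := by
  have apply_congr : ∀ z, z = y → ∀ v : EuclideanSpace ℝ (Fin d),
      (θ z : EuclideanSpace ℝ (Fin d) →L[ℝ] ℝ) v = (θ y : EuclideanSpace ℝ (Fin d) →L[ℝ] ℝ) v := by
    rintro z rfl v
    rfl
  ext v
  refine (apply_congr _ ((chartAt (EuclideanSpace ℝ (Fin d)) c).left_inv hy) _).trans ?_
  exact congrArg (θ y) <| congrArg
    (fun φ : EuclideanSpace ℝ (Fin d) →L[ℝ] EuclideanSpace ℝ (Fin d) => φ v)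
    ((mdifferentiable_chart (I := 𝓡 d) c).symm_comp_deriv hy)

theorem eventually_eq_of_hasMFDerivAt_zero {k : M → ℝ} {s : Set M} (hs : IsOpen s)
    (hk : ∀ y ∈ s, HasMFDerivAt (𝓡 d) 𝓘(ℝ, ℝ) k y 0) {x : M} (hx : x ∈ s) :
    ∀ᶠ y in 𝓝 x, k y = k x := by
  set e := chartAt (EuclideanSpace ℝ (Fin d)) x
  have hxe : x ∈ e.source := mem_chart_source _ x
  obtain ⟨r, hr, hball⟩ := Metric.isOpen_iff.1 (e.isOpen_inter_preimage_symm hs) (e x)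
    ⟨e.map_source hxe, by simpa [e.left_inv hxe] using hx⟩
  have hasFDerivAt_zero : ∀ y ∈ Metric.ball (e x) r,
      HasFDerivAt (k ∘ e.symm) (0 : _ →L[ℝ] ℝ) y := by
    intro y hy
    have := (hk _ (hball hy).2).comp y
      ((mdifferentiable_chart (I := 𝓡 d) x).mdifferentiableAt_symm (hball hy).1).hasMFDerivAt
    rwa [hasMFDerivAt_iff_hasFDerivAt, ContinuousLinearMap.zero_comp] at this
  filter_upwards [e.open_source.mem_nhds hxe,
    (e.continuousAt hxe).preimage_mem_nhds (Metric.ball_mem_nhds _ hr)] with y hy hyr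
  have := Metric.isOpen_ball.is_const_of_fderiv_eq_zero (convex_ball (e x) r).isPreconnected
    (fun y hy => (hasFDerivAt_zero y hy).differentiableAt.differentiableWithinAt)
    (fun y hy => (hasFDerivAt_zero y hy).fderiv) hyr (Metric.mem_ball_self hr)
  simpa only [Function.comp_apply, e.left_inv hxe, e.left_inv hy] using this

theorem OneForm.IsSmoothClosed.exists_localPrimitives {θ : OneForm d M} (hθ : θ.IsSmoothClosed) :
    ∃ P : LocalPrimitives M ℝ, P.IsPrimitiveOf θ := by
  choose r hr ψ contDiffOn_ψ hasFDerivAt_ψ using hθ.exists_primitive_inChart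
  let e := fun c : M => chartAt (EuclideanSpace ℝ (Fin d)) c
  let U : M → Set M := fun c => (e c).source ∩ e c ⁻¹' Metric.ball (e c c) (r c)
  have isOpen_U : ∀ c, IsOpen (U c) := fun c => (e c).isOpen_inter_preimage Metric.isOpen_ball
  have hasMFDerivAt_comp : ∀ c, ∀ y ∈ U c,
      HasMFDerivAt (𝓡 d) 𝓘(ℝ, ℝ) (ψ c ∘ e c) y (θ y) := by
    intro c y hy
    have := (hasMFDerivAt_iff_hasFDerivAt.2 (hasFDerivAt_ψ c _ hy.2)).comp y
      ((mdifferentiable_chart (I := 𝓡 d) c).mdifferentiableAt hy.1).hasMFDerivAt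
    exact θ.inChart_comp_mfderiv c hy.1 ▸ this
  refine ⟨⟨U, fun c => ψ c ∘ e c, isOpen_U,
    fun c => ⟨mem_chart_source _ c, Metric.mem_ball_self (hr c)⟩, fun i j x hx => ?_⟩,
    fun c => ?_, hasMFDerivAt_comp⟩
  · refine eventually_eq_of_hasMFDerivAt_zero (d := d)
      (k := fun y => (ψ i ∘ e i) y - (ψ j ∘ e j) y)
      ((isOpen_U i).inter (isOpen_U j)) (fun y hy => ?_) hx
    have := (hasMFDerivAt_comp i y hy.1).sub (hasMFDerivAt_comp j y hy.2)
    rwa [sub_self] at this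
  · have : ContMDiffOn (𝓡 d) (𝓡 d) ∞ (e c) (e c).source := contMDiffOn_chart
    exact (contMDiffOn_iff_contDiffOn.2 (contDiffOn_ψ c)).comp (this.mono inter_subset_left)
      inter_subset_right

end IsManifold

end Manifold

/-! ### The Abel-Jacobi-Albanese map -/

theorem locallyPathConnectedSpace_of_isLocalHomeomorph {X Y : Type*} [TopologicalSpace X]
    [TopologicalSpace Y] [LocallyPathConnectedSpace Y] {p : X → Y} (hp : IsLocalHomeomorph p) :
    LocallyPathConnectedSpace X := by
  choose e he _ using hp
  let _ : ChartedSpace Y X :=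
    { atlas := range e
      chartAt := e
      mem_chart_source := he
      chart_mem_atlas := mem_range_self }
  exact ChartedSpace.locallyPathConnectedSpace Y X

section SmoothlyJoined

variable {d : ℕ} {M : Type u} [TopologicalSpace M] [ChartedSpace (EuclideanSpace ℝ (Fin d)) M]
  {E : Type v} [TopologicalSpace E] {p : C(E, M)} {x y z : E}

variable (d) in
/-- The points `x` and `y` are joined by a curve whose projection under `p` is smooth. The curve is
required to be constant for times `t ≤ 0` and `1 ≤ t`, so that concatenations remain smooth. -/
def SmoothlyJoined (p : C(E, M)) (x y : E) : Prop :=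
  ∃ a : ℝ → E, Continuous a ∧ ContMDiff 𝓘(ℝ, ℝ) (𝓡 d) ∞ (p ∘ a) ∧
    (∀ t ≤ 0, a t = x) ∧ ∀ t ≥ 1, a t = y

namespace SmoothlyJoined

theorem symm (h : SmoothlyJoined d p x y) : SmoothlyJoined d p y x := by
  obtain ⟨a, continuous_a, contMDiff_a, ha₀, ha₁⟩ := h
  refine ⟨fun t => a (1 - t), by fun_prop,
    contMDiff_a.comp (contMDiff_iff_contDiff.2 (contDiff_const.sub contDiff_id)),
    fun t ht => ha₁ _ ?_, fun t ht => ha₀ _ ?_⟩ <;> linarith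

theorem trans (h : SmoothlyJoined d p x y) (h' : SmoothlyJoined d p y z) :
    SmoothlyJoined d p x z := by
  obtain ⟨a, continuous_a, contMDiff_a, ha₀, ha₁⟩ := h
  obtain ⟨a', continuous_a', contMDiff_a', ha'₀, ha'₁⟩ := h'
  let η : ℝ → E := fun t => if t ≤ 1 / 2 then a (3 * t) else a' (3 * t - 2)
  have eq_left {t : ℝ} (ht : t < 2 / 3) : η t = a (3 * t) := by
    by_cases h : t ≤ 1 / 2
    · exact if_pos h
    · exact (if_neg h).trans
        ((ha'₀ _ (by linarith)).trans (ha₁ _ (by linarith [not_le.1 h])).symm)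
  have eq_right {t : ℝ} (ht : 1 / 3 < t) : η t = a' (3 * t - 2) := by
    by_cases h : t ≤ 1 / 2
    · exact (if_pos h).trans ((ha₁ _ (by linarith)).trans (ha'₀ _ (by linarith)).symm)
    · exact if_neg h
  refine ⟨η, ?_, fun t => ?_, fun t ht => ?_, fun t ht => ?_⟩
  · refine Continuous.if_le (by fun_prop) (by fun_prop) continuous_id continuous_const
      fun t ht => ?_
    rw [ha₁ _ (by linarith), ha'₀ _ (by linarith)]
  · rcases lt_or_ge t (2 / 3) with ht | ht
    · refine ((contMDiff_a.comp (contMDiff_iff_contDiff.2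
        (contDiff_const.mul contDiff_id : ContDiff ℝ ∞ fun t : ℝ => 3 * t)))
        t).congr_of_eventuallyEq ?_
      filter_upwards [Iio_mem_nhds ht] with s hs using congrArg p (eq_left hs)
    · refine ((contMDiff_a'.comp (contMDiff_iff_contDiff.2
        ((contDiff_const.mul contDiff_id).sub contDiff_const :
          ContDiff ℝ ∞ fun t : ℝ => 3 * t - 2))) t).congr_of_eventuallyEq ?_
      filter_upwards [Ioi_mem_nhds (show 1 / 3 < t by linarith)] with s hs
        using congrArg p (eq_right hs)
  · rw [eq_left (by linarith), ha₀ _ (by linarith)]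
  · rw [eq_right (by linarith), ha'₁ _ (by linarith)]

theorem exists_path (h : SmoothlyJoined d p x y) :
    ∃ γ : Path x y, IsSmoothCurve d (p ∘ γ.extend) := by
  obtain ⟨a, continuous_a, contMDiff_a, ha₀, ha₁⟩ := h
  refine ⟨⟨⟨fun t => a t, by fun_prop⟩, ha₀ 0 le_rfl, ha₁ 1 le_rfl⟩,
    contMDiff_a.contMDiffOn.congr fun t ht => ?_⟩
  rw [Function.comp_apply, Path.extend_apply _ ht]
  rfl

end SmoothlyJoined

variable [IsManifold (𝓡 d) ∞ M]

theorem eventually_smoothlyJoined (hp : IsLocalHomeomorph p) (x : E) :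
    ∀ᶠ y in 𝓝 x, SmoothlyJoined d p x y := by
  obtain ⟨e, hxe, he⟩ := hp x
  let c := chartAt (EuclideanSpace ℝ (Fin d)) (p x)
  let φ := e.trans c
  have hx : x ∈ φ.source := by
    rw [OpenPartialHomeomorph.trans_source]
    exact ⟨hxe, by rw [mem_preimage, ← he]; exact mem_chart_source _ _⟩
  obtain ⟨r, hr, hball⟩ := Metric.isOpen_iff.1 φ.open_target _ (φ.map_source hx)
  filter_upwards [φ.open_source.mem_nhds hx,
    (φ.continuousAt hx).preimage_mem_nhds (Metric.ball_mem_nhds _ hr)] with y hy hyr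
  let l : ℝ → EuclideanSpace ℝ (Fin d) := fun t =>
    AffineMap.lineMap (φ x) (φ y) (Real.smoothTransition t)
  have hl (t : ℝ) : l t ∈ φ.target := hball <| (convex_ball _ _).lineMap_mem
    (Metric.mem_ball_self hr) hyr ⟨Real.smoothTransition.nonneg t, Real.smoothTransition.le_one t⟩
  have contDiff_l : ContDiff ℝ ∞ l := by
    simp only [l, AffineMap.lineMap_apply_module']
    exact (Real.smoothTransition.contDiff.smul contDiff_const).add contDiff_const
  have hl_mem (t : ℝ) : l t ∈ c.target ∧ c.symm (l t) ∈ e.target := by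
    have := hl t
    rwa [OpenPartialHomeomorph.trans_target] at this
  have p_comp : p ∘ (fun t => φ.symm (l t)) = c.symm ∘ l := by
    ext1 t
    simp only [Function.comp_apply, he]
    exact e.right_inv (hl_mem t).2
  refine ⟨fun t => φ.symm (l t), φ.continuousOn_symm.comp_continuous contDiff_l.continuous hl,
    ?_, fun t ht => ?_, fun t ht => ?_⟩
  · rw [p_comp]
    exact contMDiffOn_chart_symm.comp_contMDiff (contMDiff_iff_contDiff.2 contDiff_l)
      fun t => (hl_mem t).1
  · simp only [l, Real.smoothTransition.zero_of_nonpos ht, AffineMap.lineMap_apply_zero,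
      φ.left_inv hx]
  · simp only [l, Real.smoothTransition.one_of_one_le ht, AffineMap.lineMap_apply_one,
      φ.left_inv hy]

theorem smoothlyJoined_of_isLocalHomeomorph [PreconnectedSpace E] (hp : IsLocalHomeomorph p)
    (x y : E) : SmoothlyJoined d p x y := by
  have isClopen_setOf : IsClopen {z | SmoothlyJoined d p x z} := by
    refine ⟨⟨isOpen_iff_mem_nhds.2 fun z hz => ?_⟩, isOpen_iff_mem_nhds.2 fun z hz => ?_⟩ <;>
      filter_upwards [eventually_smoothlyJoined (d := d) hp z] with w hw
    · exact fun hxw => hz (SmoothlyJoined.trans hxw hw.symm)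
    · exact SmoothlyJoined.trans hz hw
  have := isClopen_setOf.eq_univ ⟨x, (eventually_smoothlyJoined hp x).self_of_nhds⟩
  exact eq_univ_iff_forall.1 this y

end SmoothlyJoined

section Periods

variable {d b : ℕ} {M : Type u} [TopologicalSpace M] [ChartedSpace (EuclideanSpace ℝ (Fin d)) M]

theorem LocalPrimitives.IsPrimitiveOf.pathIntegral_eq_lineIntegral {P : LocalPrimitives M ℝ}
    {φ : OneForm d M} (hP : P.IsPrimitiveOf φ) {x y : M} {γ : Path x y}
    (hγ : ContMDiffOn 𝓘(ℝ, ℝ) (𝓡 d) 1 γ.extend (Icc 0 1)) :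
    P.pathIntegral γ = φ.lineIntegral γ.extend := by
  obtain ⟨g, hg⟩ := P.exists_isPrimitiveAlong (γ : C(unitInterval, M))
  rw [hg.pathIntegral_eq, hP.lineIntegral_eq hγ (by simpa [funext_iff] using hg)]

theorem OneForm.HasPeriod.homologyIntegral_eq {P : LocalPrimitives M ℝ} {φ : OneForm d M}
    (hP : P.IsPrimitiveOf φ) {α : H1 M} {r : ℝ} (h : φ.HasPeriod α r) :
    P.homologyIntegral α = r := by
  obtain ⟨x, γ, hγ, rfl, rfl⟩ := h
  rw [P.homologyIntegral_loopClass, hP.pathIntegral_eq_lineIntegral (hγ.of_le (by simp))]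

theorem homologyIntegral_eq_repr {P : LocalPrimitives M ℝ} {φ : OneForm d M}
    (hP : P.IsPrimitiveOf φ) {Γ : Module.Basis (Fin b) ℤ (H1 M)} {i : Fin b}
    (hdual : ∀ j, φ.HasPeriod (Γ j) (if i = j then 1 else 0)) (α : H1 M) :
    P.homologyIntegral α = (Γ.repr α i : ℝ) := by
  have : P.homologyIntegral = (Int.castAddHom ℝ).toIntLinearMap ∘ₗ Γ.coord i :=
    Γ.ext fun j => by
      rw [(hdual j).homologyIntegral_eq hP]
      simp [Finsupp.single_apply, eq_comm]
  exact LinearMap.congr_fun this α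

end Periods

section AbelJacobi

variable {d b : ℕ} {M : Type u} [TopologicalSpace M] [ChartedSpace (EuclideanSpace ℝ (Fin d)) M]
  [IsManifold (𝓡 d) ∞ M] {E : Type v} [TopologicalSpace E] {p : C(E, M)}
  {θ : Fin b → OneForm d M}

theorem isPrimitiveAlong_abelJacobi (hp : IsUniversalAbelianCover p) {P : LocalPrimitives M ℝ}
    {i : Fin b} (hP : P.IsPrimitiveOf (θ i)) (x₀ : E) :
    P.IsPrimitiveAlong p fun x => abelJacobi p θ x₀ x i := by
  have := hp.pathConnectedSpace
  have hloc := hp.isCoveringMap.isLocalHomeomorph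
  have : LocallyPathConnectedSpace M :=
    ChartedSpace.locallyPathConnectedSpace (EuclideanSpace ℝ (Fin d)) M
  have : LocallyPathConnectedSpace E := locallyPathConnectedSpace_of_isLocalHomeomorph hloc
  obtain ⟨g, hg⟩ := P.exists_isPrimitiveAlong_of_range_le p fun x => (hp.range_map_eq x).le
  have eq_sub (x : E) : abelJacobi p θ x₀ x i = g x - g x₀ := by
    have h : ∃ γ : Path x₀ x, IsSmoothCurve d (p ∘ γ.extend) :=
      (smoothlyJoined_of_isLocalHomeomorph hloc x₀ x).exists_path
    have along : P.IsPrimitiveAlong (fun t : unitInterval => (p ∘ h.choose.extend) t)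
        (g ∘ h.choose) := by
      simpa only [Function.comp_def, Path.extend_apply, Subtype.coe_prop] using
        hg.comp h.choose.continuous
    rw [abelJacobi, dif_pos h, hP.lineIntegral_eq (h.choose_spec.of_le (by simp)) along]
    simp
  intro x m hm
  simpa only [eq_sub, sub_sub_sub_cancel_right] using hg x m hm

theorem continuous_abelJacobi (hp : IsUniversalAbelianCover p) (hθ : ∀ i, (θ i).IsSmoothClosed)
    (x₀ : E) : Continuous (abelJacobi p θ x₀) := by
  refine continuous_pi fun i => ?_
  obtain ⟨P, hP⟩ := (hθ i).exists_localPrimitives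
  exact hP.continuous_of_isPrimitiveAlong p.continuous (isPrimitiveAlong_abelJacobi hp hP x₀)

variable {Γ : Module.Basis (Fin b) ℤ (H1 M)}

theorem abelJacobi_eq_add_repr_loopClass (hp : IsUniversalAbelianCover p)
    (hθ : ∀ i, (θ i).IsSmoothClosed)
    (hdual : ∀ i j, (θ i).HasPeriod (Γ j) (if i = j then 1 else 0)) (x₀ : E) {x y : E}
    (h : p x = p y) (γ : Path x y) :
    abelJacobi p θ x₀ y = abelJacobi p θ x₀ x + fun i =>
      (Γ.repr (loopClass ((γ.map p.continuous).cast rfl h)) i : ℝ) := by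
  ext i
  obtain ⟨P, hP⟩ := (hθ i).exists_localPrimitives
  rw [Pi.add_apply, ← homologyIntegral_eq_repr hP (hdual i), P.homologyIntegral_loopClass,
    P.pathIntegral_cast, (isPrimitiveAlong_abelJacobi hp hP x₀).pathIntegral_map,
    add_sub_cancel]

theorem abelJacobi_deckTransformation (hp : IsUniversalAbelianCover p)
    (hθ : ∀ i, (θ i).IsSmoothClosed)
    (hdual : ∀ i j, (θ i).HasPeriod (Γ j) (if i = j then 1 else 0)) (x₀ : E) {n : Fin b → ℤ}
    {δ : E ≃ₜ E} (hδ : IsDeckTransformation p Γ n δ) (x : E) :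
    abelJacobi p θ x₀ (δ x) = abelJacobi p θ x₀ x + fun i => (n i : ℝ) := by
  have := hp.pathConnectedSpace
  obtain ⟨hpδ, hloop⟩ := hδ
  rw [abelJacobi_eq_add_repr_loopClass hp hθ hdual x₀ (hpδ x).symm
    (PathConnectedSpace.somePath x (δ x)), hloop]
  congr! 3 with i
  simp [Finsupp.single_apply]

theorem exists_abelJacobi_eq_add_intCast (hp : IsUniversalAbelianCover p)
    (hθ : ∀ i, (θ i).IsSmoothClosed)
    (hdual : ∀ i j, (θ i).HasPeriod (Γ j) (if i = j then 1 else 0)) (x₀ : E) {f : C(M, M)}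
    {F : C(E, E)} (hF : ∀ x, p (F x) = f (p x)) {x y : E} (h : p x = p y) :
    ∃ n : Fin b → ℤ, (abelJacobi p θ x₀ y = abelJacobi p θ x₀ x + fun i => (n i : ℝ)) ∧
      abelJacobi p θ x₀ (F y) =
        abelJacobi p θ x₀ (F x) + realMatrix (homologyMatrix Γ f) *ᵥ fun i => (n i : ℝ) := by
  have := hp.pathConnectedSpace
  let γ := PathConnectedSpace.somePath x y
  let η : Path (p x) (p x) := (γ.map p.continuous).cast rfl h
  have map_γ : ((γ.map F.continuous).map p.continuous).cast rfl (by rw [hF, hF, h]) =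
      (η.map f.continuous).cast (hF x) (hF x) := Path.ext (funext fun t => hF (γ t))
  refine ⟨fun i => Γ.repr (loopClass η) i, abelJacobi_eq_add_repr_loopClass hp hθ hdual x₀ h γ, ?_⟩
  rw [abelJacobi_eq_add_repr_loopClass hp hθ hdual x₀ (by rw [hF, hF, h]) (γ.map F.continuous),
    map_γ, loopClass_cast, loopClass_map, ← LinearMap.toMatrix_mulVec_repr Γ Γ (H1map f)]
  ext i
  simp [Matrix.mulVec, dotProduct, homologyMatrix]

end AbelJacobi

/-! ### The Riemannian distance on the cover -/

section Riemannian

variable {d b : ℕ} {M : Type u} [PseudoEMetricSpace M] [ChartedSpace (EuclideanSpace ℝ (Fin d)) M]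
  [RiemannianBundle (fun x : M => TangentSpace (𝓡 d) x)] {E : Type v} [TopologicalSpace E]
  {p : C(E, M)}

section Isometry

variable [IsRiemannianManifold (𝓡 d) M]

variable (p) in
theorem edist_le_coverEDist (x y : E) : edist (p x) (p y) ≤ coverEDist d p x y := by
  refine le_iInf₂ fun γ hγ => ?_
  rw [IsRiemannianManifold.out (I := 𝓡 d)]
  exact riemannianEDist_le_pathELength hγ (by simp) (by simp) zero_le_one

variable (d) in
theorem exists_curve_pathELength_lt_of_edist_lt {x y : M} {ρ : ℝ≥0∞} (h : edist x y < ρ) :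
    ∃ γ : ℝ → M, γ 0 = x ∧ γ 1 = y ∧ ContMDiffOn 𝓘(ℝ, ℝ) (𝓡 d) 1 γ (Icc 0 1) ∧
      pathELength (𝓡 d) γ 0 1 < ρ ∧ ∀ t ∈ Icc (0 : ℝ) 1, edist x (γ t) < ρ := by
  rw [IsRiemannianManifold.out (I := 𝓡 d)] at h
  obtain ⟨γ, h0, h1, hγ, hlen⟩ := exists_lt_of_riemannianEDist_lt h
  refine ⟨γ, h0, h1, hγ, hlen, fun t ht => ?_⟩
  rw [IsRiemannianManifold.out (I := 𝓡 d)]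
  calc riemannianEDist (𝓡 d) x (γ t)
    _ ≤ pathELength (𝓡 d) γ 0 t :=
      riemannianEDist_le_pathELength (hγ.mono (Icc_subset_Icc_right ht.2)) h0 rfl ht.1
    _ ≤ pathELength (𝓡 d) γ 0 1 := pathELength_mono le_rfl ht.2
    _ < ρ := hlen

theorem coverEDist_lt_of_ball_subset_target (e : OpenPartialHomeomorph E M)
    (he : (p : E → M) = e) {y z : E} (hy : y ∈ e.source) (hz : z ∈ e.source) {ρ : ℝ≥0∞}
    (hρ : Metric.eball (p y) ρ ⊆ e.target) (h : edist (p y) (p z) < ρ) :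
    coverEDist d p y z < ρ := by
  obtain ⟨γ, h0, h1, hγ, hlen, hnear⟩ := exists_curve_pathELength_lt_of_edist_lt d h
  have mem_target : ∀ t ∈ Icc (0 : ℝ) 1, γ t ∈ e.target := fun t ht =>
    hρ (Metric.mem_eball'.2 (hnear t ht))
  let lift : Path y z :=
    { toFun := fun t => e.symm (γ t)
      continuous_toFun := e.continuousOn_symm.comp_continuous
        (hγ.continuousOn.comp_continuous continuous_subtype_val fun t => t.2)
        fun t => mem_target t t.2
      source' := by simp [h0, he, hy]
      target' := by simp [h1, he, hz] }
  have lift_eq : EqOn (p ∘ lift.extend) γ (Icc 0 1) := fun t ht => by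
    simp only [Function.comp_apply, lift.extend_apply ht]
    exact (congrFun he _).trans (e.right_inv (mem_target t ht))
  exact (iInf₂_le lift (hγ.congr lift_eq)).trans_lt ((pathELength_congr lift_eq).trans_lt hlen)

theorem eventually_coverEDist_le_edist (hp : IsLocalHomeomorph p) (x : E) :
    ∀ᶠ y in 𝓝 x ×ˢ 𝓝 x, coverEDist d p y.1 y.2 ≤ edist (p y.1) (p y.2) := by
  obtain ⟨e, hx, he⟩ := hp x
  have target_mem : e.target ∈ 𝓝 (p x) := he ▸ e.open_target.mem_nhds (e.map_source hx)
  obtain ⟨ρ, hρ, ball_subset⟩ := EMetric.mem_nhds_iff.1 target_mem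
  have half_pos : 0 < ρ / 2 := ENNReal.half_pos hρ.ne'
  have near : ∀ᶠ y in 𝓝 x, y ∈ e.source ∧ edist (p y) (p x) < ρ / 2 :=
    (e.open_source.eventually_mem hx).and
      (p.continuous.continuousAt.eventually (Metric.eball_mem_nhds _ half_pos))
  have close : ∀ᶠ y in 𝓝 x ×ˢ 𝓝 x, edist (p y.1) (p y.2) < ρ / 2 := by
    rw [← nhds_prod_eq]
    have : Continuous fun y : E × E => edist (p y.1) (p y.2) := by fun_prop
    exact this.continuousAt.eventually_lt continuousAt_const (by simpa using half_pos)
  filter_upwards [near.prod_mk near, close] with ⟨y, z⟩ ⟨⟨hy, hyx⟩, hz, _⟩ hyz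
  have ball_subset_target : Metric.eball (p y) (ρ / 2) ⊆ e.target := fun m hm =>
    ball_subset <| (edist_triangle m (p y) (p x)).trans_lt <|
      (ENNReal.add_lt_add hm hyx).trans_eq (ENNReal.add_halves ρ)
  refine le_of_forall_gt fun s hs => (coverEDist_lt_of_ball_subset_target e he hy hz
    (ρ := min s (ρ / 2)) ?_ (lt_min hs hyz)).trans_le (min_le_left _ _)
  exact (Metric.eball_subset_eball (min_le_right _ _)).trans ball_subset_target

end Isometry

section Lipschitz

variable [IsManifold (𝓡 d) ∞ M] [IsContMDiffRiemannianBundle (𝓡 d) ∞ (EuclideanSpace ℝ (Fin d))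
  (fun x : M => TangentSpace (𝓡 d) x)]

attribute [local instance] normedAddCommGroupTangentSpaceVectorSpace
  normedSpaceTangentSpaceVectorSpace in
theorem OneForm.eventually_enorm_apply_le {φ : OneForm d M} {c : M}
    (hφ : ContinuousAt (φ.inChart c) (chartAt (EuclideanSpace ℝ (Fin d)) c c)) :
    ∃ K : ℝ≥0, ∀ᶠ y in 𝓝 c, ∀ v : TangentSpace (𝓡 d) y, ‖φ y v‖ₑ ≤ K * ‖v‖ₑ := by
  have : IsManifold (𝓡 d) 1 M := .of_le (n := ∞) (by simp)
  have : IsContinuousRiemannianBundle (EuclideanSpace ℝ (Fin d))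
      (fun x : M => TangentSpace (𝓡 d) x) := by
    obtain ⟨g, hg, inner_eq⟩ := IsContMDiffRiemannianBundle.exists_contMDiff (IB := 𝓡 d) (n := ∞)
      (F := EuclideanSpace ℝ (Fin d)) (E := fun x : M => TangentSpace (𝓡 d) x)
    exact ⟨g, hg.continuous, inner_eq⟩
  obtain ⟨C, -, enorm_mfderiv_lt⟩ := eventually_enorm_mfderiv_extChartAt_lt (𝓡 d) c
  let e := chartAt (EuclideanSpace ℝ (Fin d)) c
  have hc : c ∈ e.source := mem_chart_source _ c
  have enorm_inChart_lt : ∀ᶠ y in 𝓝 c, ‖φ.inChart c (e y)‖₊ < ‖φ.inChart c (e c)‖₊ + 1 :=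
    (hφ.comp (e.continuousAt hc)).nnnorm.eventually_lt continuousAt_const (lt_add_one _)
  refine ⟨(‖φ.inChart c (e c)‖₊ + 1) * C, ?_⟩
  filter_upwards [enorm_mfderiv_lt, enorm_inChart_lt, e.open_source.eventually_mem hc]
    with y hy hy' hye v
  calc ‖φ y v‖ₑ
    _ = ‖φ.inChart c (e y) (mfderiv (𝓡 d) (𝓡 d) e y v)‖ₑ := by
      rw [← φ.inChart_comp_mfderiv c hye]; rfl
    _ ≤ ‖φ.inChart c (e y)‖ₑ * ‖mfderiv (𝓡 d) (𝓡 d) e y v‖ₑ :=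
      (φ.inChart c (e y)).le_opENorm _
    _ ≤ ‖φ.inChart c (e y)‖ₑ * (C * ‖v‖ₑ) := by
      gcongr
      exact (ContinuousLinearMap.le_opENorm _ v).trans (mul_le_mul_left hy.le _)
    _ ≤ ((‖φ.inChart c (e c)‖₊ + 1) * C : ℝ≥0) * ‖v‖ₑ := by
      rw [ENNReal.coe_mul, mul_assoc]
      gcongr
      exact ENNReal.coe_le_coe.2 hy'.le

theorem OneForm.exists_forall_enorm_apply_le [CompactSpace M] {φ : OneForm d M}
    (hφ : ∀ c, ContinuousOn (φ.inChart c) (chartAt (EuclideanSpace ℝ (Fin d)) c).target) :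
    ∃ K : ℝ≥0, ∀ (y : M) (v : TangentSpace (𝓡 d) y), ‖φ y v‖ₑ ≤ K * ‖v‖ₑ := by
  suffices ∃ K : ℝ≥0, ∀ y ∈ (univ : Set M), ∀ v : TangentSpace (𝓡 d) y, ‖φ y v‖ₑ ≤ K * ‖v‖ₑ by
    simpa using this
  refine isCompact_univ.induction_on (p := fun s : Set M =>
    ∃ K : ℝ≥0, ∀ y ∈ s, ∀ v : TangentSpace (𝓡 d) y, ‖φ y v‖ₑ ≤ K * ‖v‖ₑ)
    ⟨0, by simp⟩ (fun s t hst ⟨K, hK⟩ => ⟨K, fun y hy => hK y (hst hy)⟩) ?_ fun c _ => ?_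
  · rintro s t ⟨K, hK⟩ ⟨K', hK'⟩
    refine ⟨max K K', ?_⟩
    rintro y (hy | hy) v
    · exact (hK y hy v).trans (by gcongr; exact le_max_left _ _)
    · exact (hK' y hy v).trans (by gcongr; exact le_max_right _ _)
  · obtain ⟨K, hK⟩ := OneForm.eventually_enorm_apply_le ((hφ c).continuousAt
      ((chartAt _ c).open_target.mem_nhds (mem_chart_target _ c)))
    exact ⟨_, nhdsWithin_le_nhds hK, K, fun y hy => hy⟩

variable [CompactSpace M] {θ : Fin b → OneForm d M}

theorem exists_edist_abelJacobi_le_coverEDist (hp : IsUniversalAbelianCover p)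
    (hθ : ∀ i, (θ i).IsSmoothClosed) (x₀ : E) :
    ∃ K : ℝ≥0, ∀ x y,
      edist (abelJacobi p θ x₀ x) (abelJacobi p θ x₀ y) ≤ K * coverEDist d p x y := by
  choose P hP using fun i => (hθ i).exists_localPrimitives
  choose K hK using fun i => OneForm.exists_forall_enorm_apply_le fun c =>
    ((hθ i).smooth c).continuousOn
  have along := fun i => isPrimitiveAlong_abelJacobi hp (hP i) x₀
  refine ⟨∑ i, K i + 1, fun x y => ?_⟩
  simp only [coverEDist, ENNReal.mul_iInf_of_ne (by simp : ((∑ i, K i + 1 : ℝ≥0) : ℝ≥0∞) ≠ 0)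
    ENNReal.coe_ne_top]
  refine le_iInf₂ fun γ hγ => edist_pi_le_iff.2 fun i => ?_
  have along_γ : (P i).IsPrimitiveAlong (fun t : unitInterval => (p ∘ γ.extend) t)
      fun t => abelJacobi p θ x₀ (γ t) i := by
    simpa [Function.comp_def] using (along i).comp γ.continuous
  have := (hP i).enorm_sub_le_mul_pathELength (hK i) hγ along_γ
  rw [γ.source, γ.target, ← edist_eq_enorm_sub, edist_comm] at this
  refine this.trans (mul_le_mul_left (ENNReal.coe_le_coe.2 ?_) _)
  exact (Finset.single_le_sum (fun _ _ => zero_le) (Finset.mem_univ i)).trans le_self_add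

end Lipschitz

end Riemannian

section Displacement

variable {d : ℕ} {M : Type u} [PseudoMetricSpace M] [CompactSpace M]
  [ChartedSpace (EuclideanSpace ℝ (Fin d)) M]
  [RiemannianBundle (fun x : M => TangentSpace (𝓡 d) x)] [IsRiemannianManifold (𝓡 d) M]
  {E : Type v} [TopologicalSpace E] {p : C(E, M)} {V : Type*} [SeminormedAddCommGroup V]

theorem exists_lipschitzWith_of_comp_eq_sub (hp : IsLocalHomeomorph p)
    (hsurj : Function.Surjective p) {f : M → M} {F : C(E, E)} (hF : ∀ x, p (F x) = f (p x))
    {L : ℝ≥0} (hf : LipschitzWith L f) {ι : E → V} {K : ℝ≥0}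
    (hι : ∀ x y, edist (ι x) (ι y) ≤ K * coverEDist d p x y) {T : V → V} {K' : ℝ≥0}
    (hT : LipschitzWith K' T) {σ : M → V} (hσ : ∀ x, σ (p x) = ι (F x) - T (ι x)) :
    ∃ C, LipschitzWith C σ := by
  suffices LocallyLipschitz σ by
    obtain ⟨C, hC⟩ := this.locallyLipschitzOn.exists_lipschitzOnWith_of_compact
      (isCompact_univ (X := M))
    exact ⟨C, lipschitzOnWith_univ.1 hC⟩
  intro m
  obtain ⟨x, rfl⟩ := hsurj m
  have coverEDist_F_le : ∀ᶠ y in 𝓝 x ×ˢ 𝓝 x,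
      coverEDist d p (F y.1) (F y.2) ≤ edist (p (F y.1)) (p (F y.2)) := by
    have := F.continuous.tendsto x
    exact (this.prodMap this).eventually (eventually_coverEDist_le_edist hp (F x))
  obtain ⟨s, hs, edist_le⟩ := Filter.mem_prod_same_iff.1
    ((eventually_coverEDist_le_edist (d := d) hp x).and coverEDist_F_le)
  refine ⟨K * L + K' * K, p '' s, hp.isOpenMap.image_mem_nhds hs, ?_⟩
  rintro _ ⟨y, hy, rfl⟩ _ ⟨z, hz, rfl⟩
  obtain ⟨hyz, hFyz⟩ := edist_le (mk_mem_prod hy hz)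
  rw [hF, hF] at hFyz
  calc edist (σ (p y)) (σ (p z))
    _ ≤ edist (ι (F y)) (ι (F z)) + edist (T (ι y)) (T (ι z)) := by
      simpa only [hσ, sub_eq_add_neg, edist_neg_neg] using
        edist_add_add_le (ι (F y)) (-T (ι y)) (ι (F z)) (-T (ι z))
    _ ≤ K * (L * edist (p y) (p z)) + K' * (K * edist (p y) (p z)) := by
      gcongr
      · exact (hι _ _).trans (by gcongr; exact hFyz.trans (hf _ _))
      · exact (hT _ _).trans (by gcongr; exact (hι _ _).trans (by gcongr))
    _ = (K * L + K' * K : ℝ≥0) * edist (p y) (p z) := by push_cast; ring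

end Displacement

/-! ### Powers of the inverse of an expanding matrix -/

theorem summable_norm_pow_mul_of_lt_inv_spectralRadius {R : Type*} [NormedRing R]
    [NormedAlgebra ℂ R] [CompleteSpace R] {a : R} {r : ℝ≥0} (hr : r < (spectralRadius ℂ a)⁻¹) :
    Summable fun n => ‖a ^ n‖ * (r : ℝ) ^ n := by
  obtain ⟨s, hrs, hs⟩ := ENNReal.lt_iff_exists_nnreal_btwn.1 hr
  have hs₀ : 0 < s := pos_of_gt (ENNReal.coe_lt_coe.1 hrs)
  have neumann := (spectrum.hasFPowerSeriesOnBall_inverse_one_sub_smul ℂ a).exchange_radius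
    ((spectrum.differentiableOn_inverse_one_sub_smul hs).hasFPowerSeriesOnBall hs₀)
  simpa only [ContinuousMultilinearMap.norm_mkPiRing] using
    FormalMultilinearSeries.summable_norm_mul_pow _ (hrs.trans_le neumann.r_le)

section ExpandingMatrix

open scoped Matrix.Norms.Operator

theorem norm_map_ofReal {m n : Type*} [Fintype m] [Fintype n] (B : Matrix m n ℝ) :
    ‖B.map Complex.ofReal‖ = ‖B‖ := by
  simp [Matrix.linfty_opNorm_def]

theorem map_ofReal_inv {n : Type*} [Fintype n] [DecidableEq n] (B : Matrix n n ℝ) :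
    (B⁻¹).map Complex.ofReal = (B.map Complex.ofReal)⁻¹ := by
  have map_adjugate : B.adjugate.map Complex.ofReal = (B.map Complex.ofReal).adjugate :=
    RingHom.map_adjugate Complex.ofRealHom B
  have map_det : (B.det : ℂ) = (B.map Complex.ofReal).det := RingHom.map_det Complex.ofRealHom B
  rw [Matrix.inv_def, Matrix.inv_def, ← map_adjugate, ← map_det]
  ext i j
  simp

variable {b : ℕ} {A : Matrix (Fin b) (Fin b) ℤ}

theorem map_ofReal_realMatrix (A : Matrix (Fin b) (Fin b) ℤ) :
    (realMatrix A).map Complex.ofReal = complexMatrix A := by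
  ext i j
  simp

theorem norm_inv_pow_realMatrix (A : Matrix (Fin b) (Fin b) ℤ) (n : ℕ) :
    ‖(realMatrix A)⁻¹ ^ n‖ = ‖(complexMatrix A)⁻¹ ^ n‖ := by
  rw [← norm_map_ofReal, ← map_ofReal_realMatrix, ← map_ofReal_inv]
  exact congrArg _ (map_pow Complex.ofRealHom.mapMatrix _ n)

theorem summable_norm_inv_pow_mul {r : ℝ≥0}
    (hr : r < (spectralRadius ℂ (complexMatrix A)⁻¹)⁻¹) :
    Summable fun n => ‖(realMatrix A)⁻¹ ^ n‖ * (r : ℝ) ^ n := by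
  have : CompleteSpace (Matrix (Fin b) (Fin b) ℂ) := FiniteDimensional.complete ℂ _
  simp only [norm_inv_pow_realMatrix]
  exact summable_norm_pow_mul_of_lt_inv_spectralRadius hr

namespace IsExpandingMatrix

theorem isUnit_complexMatrix (hA : IsExpandingMatrix A) : IsUnit (complexMatrix A) := by
  by_contra h
  have := hA 0 (spectrum.zero_mem ℂ h)
  rw [norm_zero] at this
  exact this.not_ge zero_le_one

theorem isUnit_det_realMatrix (hA : IsExpandingMatrix A) : IsUnit (realMatrix A).det := by
  have := (Matrix.isUnit_iff_isUnit_det _).1 hA.isUnit_complexMatrix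
  have map_det : ((realMatrix A).det : ℂ) = (complexMatrix A).det :=
    (RingHom.map_det Complex.ofRealHom _).trans (congrArg _ (map_ofReal_realMatrix A))
  rw [← map_det, isUnit_iff_ne_zero] at this
  exact isUnit_iff_ne_zero.2 (mod_cast this)

theorem norm_lt_one_of_mem_spectrum_inv (hA : IsExpandingMatrix A) {k : ℂ}
    (hk : k ∈ spectrum ℂ (complexMatrix A)⁻¹) : ‖k‖ < 1 := by
  obtain ⟨a, ha⟩ := hA.isUnit_complexMatrix
  rw [← ha, ← Matrix.coe_units_inv] at hk
  have hk₀ : k ≠ 0 := fun h => spectrum.zero_notMem ℂ a⁻¹.isUnit (h ▸ hk)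
  have inv_mem : ((Units.mk0 k hk₀)⁻¹ : ℂˣ).1 ∈ spectrum ℂ (complexMatrix A) := by
    simpa only [inv_inv, ha] using (spectrum.inv_mem_iff (r := Units.mk0 k hk₀)).1 hk
  have := hA _ inv_mem
  rw [Units.val_inv_eq_inv_val, Units.val_mk0, norm_inv] at this
  exact (one_lt_inv_iff₀.1 this).2

theorem spectralRadius_inv_lt_one (hA : IsExpandingMatrix A) :
    spectralRadius ℂ (complexMatrix A)⁻¹ < 1 := by
  have : CompleteSpace (Matrix (Fin b) (Fin b) ℂ) := FiniteDimensional.complete ℂ _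
  rcases (spectrum ℂ (complexMatrix A)⁻¹).eq_empty_or_nonempty with empty | nonempty
  · simp [spectralRadius, empty]
  · exact spectrum.spectralRadius_lt_of_forall_lt_of_nonempty nonempty
      fun k hk => hA.norm_lt_one_of_mem_spectrum_inv hk

theorem summable_norm_inv_pow (hA : IsExpandingMatrix A) :
    Summable fun n => ‖(realMatrix A)⁻¹ ^ n‖ := by
  simpa only [NNReal.coe_one, one_pow, mul_one] using
    summable_norm_inv_pow_mul (r := 1) (ENNReal.one_lt_inv.2 hA.spectralRadius_inv_lt_one)

end IsExpandingMatrix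

end ExpandingMatrix

/-! ### The limit of the rescaled orbits -/

theorem holderWith_of_dist_le {X Y : Type*} [PseudoMetricSpace X] [PseudoMetricSpace Y]
    {f : X → Y} {C ν : ℝ≥0} (h : ∀ x y, dist (f x) (f y) ≤ C * dist x y ^ (ν : ℝ)) :
    HolderWith C ν f := fun x y => by
  rw [edist_nndist, edist_nndist, ← ENNReal.coe_rpow_of_nonneg _ ν.coe_nonneg, ← ENNReal.coe_mul,
    ENNReal.coe_le_coe]
  exact_mod_cast h x y

section CorrectionSeries

open scoped Matrix.Norms.Operator

variable {n X : Type*} [Fintype n] [DecidableEq n]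

/-- The series `∑ Bᵏ⁺¹ σ(fᵏ x)`. For `B = A⁻¹` and `σ` the displacement `ι̃ ∘ F - A ι̃`, it is the
difference between the limit map and the Abel-Jacobi-Albanese map. As with every `tsum`, its value
is `0` at a point where the series diverges. -/
def correctionSeries (B : Matrix n n ℝ) (f : X → X) (σ : X → n → ℝ) (x : X) : n → ℝ :=
  ∑' k : ℕ, B ^ (k + 1) *ᵥ σ (f^[k] x)

variable {B : Matrix n n ℝ} {f : X → X} {σ : X → n → ℝ} {K : ℝ}

theorem norm_pow_succ_mulVec_iterate_le (hσ : ∀ x, ‖σ x‖ ≤ K) (k : ℕ) (x : X) :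
    ‖B ^ (k + 1) *ᵥ σ (f^[k] x)‖ ≤ ‖B ^ (k + 1)‖ * K :=
  (Matrix.linfty_opNorm_mulVec _ _).trans (by gcongr; exact hσ _)

theorem hasSum_correctionSeries (hB : Summable fun k => ‖B ^ k‖) (hσ : ∀ x, ‖σ x‖ ≤ K) (x : X) :
    HasSum (fun k => B ^ (k + 1) *ᵥ σ (f^[k] x)) (correctionSeries B f σ x) :=
  (Summable.of_norm_bounded (((summable_nat_add_iff 1).2 hB).mul_right K)
    fun k => norm_pow_succ_mulVec_iterate_le hσ k x).hasSum

theorem norm_correctionSeries_le (hB : Summable fun k => ‖B ^ k‖) (hσ : ∀ x, ‖σ x‖ ≤ K) (x : X) :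
    ‖correctionSeries B f σ x‖ ≤ (∑' k, ‖B ^ (k + 1)‖) * K :=
  tsum_of_norm_bounded (((summable_nat_add_iff 1).2 hB).hasSum.mul_right K)
    fun k => norm_pow_succ_mulVec_iterate_le hσ k x

theorem continuous_correctionSeries [TopologicalSpace X] (hB : Summable fun k => ‖B ^ k‖)
    (hσ : ∀ x, ‖σ x‖ ≤ K) (hfc : Continuous f) (hσc : Continuous σ) :
    Continuous (correctionSeries B f σ) :=
  continuous_tsum (fun k => continuous_const.matrix_mulVec (hσc.comp (hfc.iterate k)))
    (((summable_nat_add_iff 1).2 hB).mul_right K)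
    fun k x => norm_pow_succ_mulVec_iterate_le hσ k x

theorem exists_holderWith_correctionSeries [PseudoMetricSpace X] {L C ν : ℝ≥0}
    (hB : Summable fun k => ‖B ^ k‖) (hσ : ∀ x, ‖σ x‖ ≤ K) (hf : LipschitzWith L f)
    (hσC : HolderWith C ν σ) (hBL : Summable fun k => ‖B ^ k‖ * (L ^ (ν : ℝ) : ℝ) ^ k) :
    ∃ D, HolderWith D ν (correctionSeries B f σ) := by
  have norm_term_sub_le (x y : X) (k : ℕ) :
      ‖B ^ (k + 1) *ᵥ σ (f^[k] x) - B ^ (k + 1) *ᵥ σ (f^[k] y)‖ ≤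
        ‖B ^ k‖ * (L ^ (ν : ℝ) : ℝ) ^ k * (‖B‖ * C) * dist x y ^ (ν : ℝ) := by
    have dist_iterate_le : dist (σ (f^[k] x)) (σ (f^[k] y)) ≤
        C * ((L ^ (ν : ℝ) : ℝ) ^ k * dist x y ^ (ν : ℝ)) := by
      refine (hσC.dist_le_of_le ((hf.iterate k).dist_le_mul x y)).trans_eq ?_
      rw [NNReal.coe_pow, Real.mul_rpow (by positivity) dist_nonneg,
        Real.rpow_pow_comm L.coe_nonneg]
    calc ‖B ^ (k + 1) *ᵥ σ (f^[k] x) - B ^ (k + 1) *ᵥ σ (f^[k] y)‖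
      _ ≤ ‖B ^ k‖ * ‖B‖ * dist (σ (f^[k] x)) (σ (f^[k] y)) := by
        rw [← Matrix.mulVec_sub, dist_eq_norm, pow_succ]
        exact (Matrix.linfty_opNorm_mulVec _ _).trans (by gcongr; exact norm_mul_le _ _)
      _ ≤ ‖B ^ k‖ * ‖B‖ * (C * ((L ^ (ν : ℝ) : ℝ) ^ k * dist x y ^ (ν : ℝ))) := by gcongr
      _ = ‖B ^ k‖ * (L ^ (ν : ℝ) : ℝ) ^ k * (‖B‖ * C) * dist x y ^ (ν : ℝ) := by ring
  have coeff_nonneg : 0 ≤ (∑' k, ‖B ^ k‖ * (L ^ (ν : ℝ) : ℝ) ^ k) * (‖B‖ * C) :=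
    mul_nonneg (tsum_nonneg fun k => by positivity) (by positivity)
  refine ⟨⟨_, coeff_nonneg⟩, holderWith_of_dist_le fun x y => ?_⟩
  rw [dist_eq_norm,
    ← ((hasSum_correctionSeries hB hσ x).sub (hasSum_correctionSeries hB hσ y)).tsum_eq]
  exact tsum_of_norm_bounded ((hBL.hasSum.mul_right _).mul_right _) (norm_term_sub_le x y)

end CorrectionSeries

section Seminorm

variable {V : Type*} [NormedAddCommGroup V] [NormedSpace ℝ V] [FiniteDimensional ℝ V]

theorem continuous_seminorm_of_finiteDimensional (N : Seminorm ℝ V) : Continuous N :=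
  continuousOn_univ.1 (N.convexOn.continuousOn isOpen_univ)

theorem exists_norm_le_mul_seminorm (N : Seminorm ℝ V) (hN : ∀ v, N v = 0 → v = 0) :
    ∃ C, 0 < C ∧ ∀ v, ‖v‖ ≤ C * N v := by
  rcases subsingleton_or_nontrivial V with _ | _
  · exact ⟨1, one_pos, fun v => by simp [Subsingleton.elim v 0]⟩
  obtain ⟨v₀, hv₀, N_v₀_le⟩ := (isCompact_sphere (0 : V) 1).exists_isMinOn
    (NormedSpace.sphere_nonempty.2 zero_le_one)
    (continuous_seminorm_of_finiteDimensional N).continuousOn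
  have N_v₀_pos : 0 < N v₀ := (apply_nonneg N v₀).lt_of_ne' fun h => by simp [hN v₀ h] at hv₀
  refine ⟨(N v₀)⁻¹, inv_pos.2 N_v₀_pos, fun v => ?_⟩
  rcases eq_or_ne v 0 with rfl | hv
  · simp
  have := N_v₀_le (show ‖v‖⁻¹ • v ∈ Metric.sphere (0 : V) 1 by simp [norm_smul, hv])
  rw [mem_ofPred_eq, map_smul_eq_mul, norm_inv, norm_norm, ← div_eq_inv_mul,
    le_div_iff₀ (norm_pos_iff.2 hv)] at this
  rwa [← div_eq_inv_mul, le_div_iff₀ N_v₀_pos, mul_comm]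

end Seminorm

section Limit

variable {b : ℕ} {A : Matrix (Fin b) (Fin b) ℝ} {X : Type*} {E : Type v} {p : E → X} {F : E → E}
  {f : X → X} {ι β : E → Fin b → ℝ} {σ : X → Fin b → ℝ}

theorem add_sum_range_inv_pow_succ_mulVec (hA : IsUnit A.det) (hF : ∀ x, p (F x) = f (p x))
    (hσ : ∀ x, σ (p x) = ι (F x) - A *ᵥ ι x) (x : E) (n : ℕ) :
    ι x + ∑ k ∈ Finset.range n, A⁻¹ ^ (k + 1) *ᵥ σ (f^[k] (p x)) = A⁻¹ ^ n *ᵥ ι (F^[n] x) := by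
  induction n with
  | zero => simp
  | succ n ih =>
    have iterate_comm : f^[n] (p x) = p (F^[n] x) :=
      ((show Function.Semiconj p F f from hF).iterate_right n x).symm
    have pow_succ_mul : A⁻¹ ^ (n + 1) * A = A⁻¹ ^ n := by
      rw [pow_succ, mul_assoc, Matrix.nonsing_inv_mul A hA, mul_one]
    rw [Finset.sum_range_succ, ← add_assoc, ih, iterate_comm, hσ, Matrix.mulVec_sub,
      Matrix.mulVec_mulVec, pow_succ_mul, Function.iterate_succ_apply', add_sub_cancel]

theorem tendsto_inv_pow_mulVec_iterate (hA : IsUnit A.det) (hF : ∀ x, p (F x) = f (p x))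
    (hσ : ∀ x, σ (p x) = ι (F x) - A *ᵥ ι x) {x : E} {s : Fin b → ℝ}
    (hs : HasSum (fun k => A⁻¹ ^ (k + 1) *ᵥ σ (f^[k] (p x))) s) :
    Tendsto (fun n : ℕ => A⁻¹ ^ n *ᵥ ι (F^[n] x)) atTop (𝓝 (ι x + s)) := by
  simp only [← add_sum_range_inv_pow_succ_mulVec hA hF hσ]
  exact hs.tendsto_sum_nat.const_add _

theorem apply_eq_mulVec_of_tendsto (hA : IsUnit A.det)
    (hβ : ∀ x, Tendsto (fun n : ℕ => A⁻¹ ^ n *ᵥ ι (F^[n] x)) atTop (𝓝 (β x))) (x : E) :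
    β (F x) = A *ᵥ β x := by
  have tendsto_mulVec : Tendsto (fun n : ℕ => A *ᵥ (A⁻¹ ^ (n + 1) *ᵥ ι (F^[n + 1] x))) atTop
      (𝓝 (A *ᵥ β x)) :=
    ((continuous_const.matrix_mulVec continuous_id).tendsto _).comp
      ((hβ x).comp (tendsto_add_atTop_nat 1))
  refine tendsto_nhds_unique (hβ (F x)) (tendsto_mulVec.congr fun n => ?_)
  rw [Matrix.mulVec_mulVec, pow_succ', ← mul_assoc, Matrix.mul_nonsing_inv A hA, one_mul,
    Function.iterate_succ_apply]

theorem apply_iterate_eq_pow_mulVec (hβ : ∀ x, β (F x) = A *ᵥ β x) (n : ℕ) (x : E) :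
    β (F^[n] x) = A ^ n *ᵥ β x := by
  induction n with
  | zero => simp
  | succ n ih => rw [Function.iterate_succ_apply', hβ, ih, Matrix.mulVec_mulVec, pow_succ']

variable {N : Seminorm ℝ (Fin b → ℝ)} {x : E} {y : Fin b → ℝ}

namespace GloballyShadows

theorem of_norm_sub_le (N : Seminorm ℝ (Fin b → ℝ)) (hβ : ∀ x, β (F x) = A *ᵥ β x) {D : ℝ}
    (hD : ∀ x, ‖ι x - β x‖ ≤ D) (x : E) : GloballyShadows N ι F A x (β x) := by
  obtain ⟨C, hC, N_le⟩ :=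
    N.bound_of_continuous_normedSpace (continuous_seminorm_of_finiteDimensional N)
  refine ⟨C * D, fun n => (N_le _).trans ?_⟩
  rw [← apply_iterate_eq_pow_mulVec hβ]
  exact mul_le_mul_of_nonneg_left (hD _) hC.le

open scoped Matrix.Norms.Operator in
theorem eq_of_tendsto (h : GloballyShadows N ι F A x y) (hN : ∀ v, N v = 0 → v = 0)
    (hA : IsUnit A.det) (hAinv : Tendsto (fun n => ‖A⁻¹ ^ n‖) atTop (𝓝 0)) {z : Fin b → ℝ}
    (hz : Tendsto (fun n : ℕ => A⁻¹ ^ n *ᵥ ι (F^[n] x)) atTop (𝓝 z)) : y = z := by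
  obtain ⟨K, hK⟩ := h
  obtain ⟨C, hC, norm_le⟩ := exists_norm_le_mul_seminorm N hN
  have tendsto_zero : Tendsto (fun n => A⁻¹ ^ n *ᵥ (ι (F^[n] x) - A ^ n *ᵥ y)) atTop (𝓝 0) := by
    refine squeeze_zero_norm (a := fun n => ‖A⁻¹ ^ n‖ * (C * K)) (fun n => ?_)
      (by simpa only [zero_mul] using hAinv.mul_const (C * K))
    refine (Matrix.linfty_opNorm_mulVec _ _).trans (mul_le_mul_of_nonneg_left ?_ (norm_nonneg _))
    exact (norm_le _).trans (mul_le_mul_of_nonneg_left (hK n) hC.le)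
  have tendsto_sub : Tendsto (fun n => A⁻¹ ^ n *ᵥ (ι (F^[n] x) - A ^ n *ᵥ y)) atTop
      (𝓝 (z - y)) := by
    refine (hz.sub_const y).congr fun n => ?_
    rw [Matrix.mulVec_sub, Matrix.mulVec_mulVec, Matrix.inv_pow',
      Matrix.nonsing_inv_mul _ (by rw [Matrix.det_pow]; exact hA.pow n), Matrix.one_mulVec]
  exact (sub_eq_zero.1 (tendsto_nhds_unique tendsto_sub tendsto_zero)).symm

end GloballyShadows

theorem shadowingMap_eq_of_globallyShadows_iff {z : Fin b → ℝ}
    (h : ∀ y, GloballyShadows N ι F A x y ↔ y = z) : shadowingMap N ι F A x = z := by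
  have exists_unique : ∃! y, GloballyShadows N ι F A x y := ⟨z, (h z).2 rfl, fun y => (h y).1⟩
  rw [shadowingMap, dif_pos exists_unique]
  exact (h _).1 exists_unique.choose_spec.1

end Limit

section LimitMap

open scoped Matrix.Norms.Operator

variable {b : ℕ} {A : Matrix (Fin b) (Fin b) ℝ} {X : Type*} {E : Type v} {p : E → X} {F : E → E}
  {f : X → X} {ι : E → Fin b → ℝ} {σ : X → Fin b → ℝ} {K : ℝ}

/-- The map `β̃ = ι̃ + ∑ A⁻⁽ᵏ⁺¹⁾ σ(fᵏ p)` on the cover. It is defined by the series rather than by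
the limit of the rescaled orbits `A⁻ⁿ ι̃(Fⁿ x)`, since the series gives its regularity. -/
def limitMap (A : Matrix (Fin b) (Fin b) ℝ) (ι : E → Fin b → ℝ) (p : E → X) (f : X → X)
    (σ : X → Fin b → ℝ) (x : E) : Fin b → ℝ :=
  ι x + correctionSeries A⁻¹ f σ (p x)

theorem limitMap_eq_add {x y : E} {v : Fin b → ℝ} (hp : p x = p y) (hι : ι y = ι x + v) :
    limitMap A ι p f σ y = limitMap A ι p f σ x + v := by
  rw [limitMap, limitMap, hι, hp, add_right_comm]

theorem hasSum_limitMap_sub (hAinv : Summable fun n => ‖A⁻¹ ^ n‖) (hσK : ∀ x, ‖σ x‖ ≤ K) (x : E) :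
    HasSum (fun n => A⁻¹ ^ (n + 1) *ᵥ σ (f^[n] (p x))) (limitMap A ι p f σ x - ι x) := by
  simpa only [limitMap, add_sub_cancel_left] using hasSum_correctionSeries hAinv hσK (p x)

theorem continuous_limitMap [TopologicalSpace X] [TopologicalSpace E]
    (hAinv : Summable fun n => ‖A⁻¹ ^ n‖) (hσK : ∀ x, ‖σ x‖ ≤ K) (hι : Continuous ι)
    (hp : Continuous p) (hf : Continuous f) (hσ : Continuous σ) :
    Continuous (limitMap A ι p f σ) :=
  hι.add ((continuous_correctionSeries hAinv hσK hf hσ).comp hp)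

theorem tendsto_limitMap (hA : IsUnit A.det) (hAinv : Summable fun n => ‖A⁻¹ ^ n‖)
    (hF : ∀ x, p (F x) = f (p x)) (hσ : ∀ x, σ (p x) = ι (F x) - A *ᵥ ι x)
    (hσK : ∀ x, ‖σ x‖ ≤ K) (x : E) :
    Tendsto (fun n : ℕ => A⁻¹ ^ n *ᵥ ι (F^[n] x)) atTop (𝓝 (limitMap A ι p f σ x)) :=
  tendsto_inv_pow_mulVec_iterate hA hF hσ (hasSum_correctionSeries hAinv hσK (p x))

theorem globallyShadows_iff_eq_limitMap {N : Seminorm ℝ (Fin b → ℝ)}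
    (hN : ∀ v, N v = 0 → v = 0) (hA : IsUnit A.det) (hAinv : Summable fun n => ‖A⁻¹ ^ n‖)
    (hF : ∀ x, p (F x) = f (p x)) (hσ : ∀ x, σ (p x) = ι (F x) - A *ᵥ ι x)
    (hσK : ∀ x, ‖σ x‖ ≤ K) {x : E} {y : Fin b → ℝ} :
    GloballyShadows N ι F A x y ↔ y = limitMap A ι p f σ x := by
  have tendsto_limit := tendsto_limitMap hA hAinv hF hσ hσK
  have norm_sub_le (x : E) : ‖ι x - limitMap A ι p f σ x‖ ≤ (∑' k, ‖A⁻¹ ^ (k + 1)‖) * K := by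
    rw [limitMap, sub_add_cancel_left, norm_neg]
    exact norm_correctionSeries_le hAinv hσK (p x)
  refine ⟨fun h => h.eq_of_tendsto hN hA hAinv.tendsto_atTop_zero (tendsto_limit x), ?_⟩
  rintro rfl
  exact .of_norm_sub_le N (apply_eq_mulVec_of_tendsto hA tendsto_limit) norm_sub_le x

end LimitMap

/-! ### Hölder continuity of the limit -/

theorem rpow_lt_of_lt_log_div_log {x y z : ℝ} (hy : 1 < y) (hx : 0 ≤ x) (hz : 0 < z)
    (h : z < Real.log y / Real.log x) : x ^ z < y := by
  have log_x_pos : 0 < Real.log x :=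
    (div_pos_iff_of_pos_left (Real.log_pos hy)).1 (hz.trans h)
  have x_pos : 0 < x := hx.lt_of_ne fun hx₀ => by simp [← hx₀] at log_x_pos
  rw [← Real.log_lt_log_iff (by positivity) (by positivity), Real.log_rpow x_pos]
  exact (lt_div_iff₀ log_x_pos).1 h

theorem exists_seminorm_sub_le_mul_toReal_rpow {X V : Type*} [NormedAddCommGroup V]
    [NormedSpace ℝ V] [FiniteDimensional ℝ V] (N : Seminorm ℝ V) {dX : X → X → ℝ≥0∞} {g : X → V}
    {K D ν : ℝ≥0} (hν : ν ≤ 1)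
    (hg : ∀ x y, edist (g x) (g y) ≤ K * dX x y + D * dX x y ^ (ν : ℝ)) (R : ℝ) :
    ∃ C : ℝ, ∀ x y, dX x y ≤ ENNReal.ofReal R →
      N (g x - g y) ≤ C * (dX x y).toReal ^ (ν : ℝ) := by
  obtain ⟨c, hc, N_le⟩ :=
    N.bound_of_continuous_normedSpace (continuous_seminorm_of_finiteDimensional N)
  refine ⟨c * (K * R.toNNReal ^ (1 - ν : ℝ) + D), fun x y hxy => ?_⟩
  have edist_le := hg x y
  generalize dX x y = t at hxy edist_le
  lift t to ℝ≥0 using ne_top_of_le_ne_top ENNReal.ofReal_ne_top hxy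
  have t_le : t ≤ R.toNNReal ^ (1 - ν : ℝ) * t ^ (ν : ℝ) := by
    calc t
      _ = t ^ (1 - ν : ℝ) * t ^ (ν : ℝ) := by
        rw [← NNReal.rpow_add_of_nonneg _ (by simpa using hν) ν.coe_nonneg, sub_add_cancel,
          NNReal.rpow_one]
      _ ≤ R.toNNReal ^ (1 - ν : ℝ) * t ^ (ν : ℝ) := by
        gcongr
        · simpa using hν
        · exact ENNReal.coe_le_coe.1 hxy
  have nndist_le : nndist (g x) (g y) ≤ K * t + D * t ^ (ν : ℝ) := by
    rwa [edist_nndist, ← ENNReal.coe_rpow_of_nonneg _ ν.coe_nonneg, ← ENNReal.coe_mul,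
      ← ENNReal.coe_mul, ← ENNReal.coe_add, ENNReal.coe_le_coe] at edist_le
  have norm_le : ‖g x - g y‖ ≤ (K * R.toNNReal ^ (1 - ν : ℝ) + D) * t ^ (ν : ℝ) := by
    rw [← dist_eq_norm, ← coe_nndist, add_mul, mul_assoc]
    exact_mod_cast nndist_le.trans (by gcongr)
  rw [mul_assoc]
  exact (N_le _).trans (mul_le_mul_of_nonneg_left norm_le hc.le)

section Holder

variable {d b : ℕ} {M : Type u} [PseudoMetricSpace M] [CompactSpace M]
  [ChartedSpace (EuclideanSpace ℝ (Fin d)) M] [IsManifold (𝓡 d) ∞ M]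
  [RiemannianBundle (fun x : M => TangentSpace (𝓡 d) x)]
  [IsContMDiffRiemannianBundle (𝓡 d) ∞ (EuclideanSpace ℝ (Fin d))
    (fun x : M => TangentSpace (𝓡 d) x)]
  [IsRiemannianManifold (𝓡 d) M]
  {E : Type v} [TopologicalSpace E] {p : C(E, M)} {θ : Fin b → OneForm d M} {x₀ : E}
  {f : M → M} {F : C(E, E)} {σ : C(M, Fin b → ℝ)} {L ν : ℝ≥0}

open scoped Matrix.Norms.Operator in
theorem exists_edist_limitMap_le (hp : IsUniversalAbelianCover p)
    (hsurj : Function.Surjective p) (hθ : ∀ i, (θ i).IsSmoothClosed)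
    (hF : ∀ x, p (F x) = f (p x)) (hf : LipschitzWith L f) {A : Matrix (Fin b) (Fin b) ℝ}
    (hσ : ∀ x, σ (p x) = abelJacobi p θ x₀ (F x) - A *ᵥ abelJacobi p θ x₀ x)
    (hAinv : Summable fun k => ‖A⁻¹ ^ k‖)
    (hAL : Summable fun k => ‖A⁻¹ ^ k‖ * (L ^ (ν : ℝ) : ℝ) ^ k) (hν : ν ≤ 1) :
    ∃ K D : ℝ≥0, ∀ x y, edist (limitMap A (abelJacobi p θ x₀) p f σ x)
      (limitMap A (abelJacobi p θ x₀) p f σ y) ≤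
        K * coverEDist d p x y + D * coverEDist d p x y ^ (ν : ℝ) := by
  obtain ⟨K, edist_abelJacobi_le⟩ := exists_edist_abelJacobi_le_coverEDist hp hθ x₀
  obtain ⟨K', hσ_lipschitz⟩ := exists_lipschitzWith_of_comp_eq_sub
    hp.isCoveringMap.isLocalHomeomorph hsurj hF hf edist_abelJacobi_le
    A.mulVecLin.toContinuousLinearMap.lipschitz hσ
  obtain ⟨C, hσ_holder⟩ := (holderWith_one.2 hσ_lipschitz).memHolder.of_le hν
  obtain ⟨D, hS⟩ := exists_holderWith_correctionSeries hAinv σ.norm_coe_le_norm hf hσ_holder hAL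
  refine ⟨K, D, fun x y => (edist_add_add_le _ _ _ _).trans ?_⟩
  exact add_le_add (edist_abelJacobi_le x y) (hS.edist_le_of_le (edist_le_coverEDist p x y))

theorem exists_seminorm_limitMap_sub_le (hp : IsUniversalAbelianCover p)
    (hsurj : Function.Surjective p) (hθ : ∀ i, (θ i).IsSmoothClosed)
    (hF : ∀ x, p (F x) = f (p x)) (hf : LipschitzWith L f) {A : Matrix (Fin b) (Fin b) ℤ}
    (hA : IsExpandingMatrix A)
    (hσ : ∀ x, σ (p x) = abelJacobi p θ x₀ (F x) - realMatrix A *ᵥ abelJacobi p θ x₀ x)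
    {lam : ℝ} (hlam : 1 < lam)
    (hspec : spectralRadius ℂ (complexMatrix A)⁻¹ < ENNReal.ofReal (1 / lam)) {r : ℝ}
    (hr₀ : 0 < r) (hr : r < min (Real.log lam / Real.log L) 1) (N : Seminorm ℝ (Fin b → ℝ))
    (R : ℝ) :
    ∃ C : ℝ, ∀ x y, coverEDist d p x y ≤ ENNReal.ofReal R →
      N (limitMap (realMatrix A) (abelJacobi p θ x₀) p f σ x -
        limitMap (realMatrix A) (abelJacobi p θ x₀) p f σ y) ≤
          C * (coverEDist d p x y).toReal ^ r := by
  obtain ⟨hr_log, hr_one⟩ := lt_min_iff.1 hr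
  lift r to ℝ≥0 using hr₀.le
  have rpow_lt : ((L ^ (r : ℝ) : ℝ≥0) : ℝ≥0∞) < (spectralRadius ℂ (complexMatrix A)⁻¹)⁻¹ := by
    refine ENNReal.lt_inv_iff_lt_inv.2 (hspec.trans ?_)
    rw [ENNReal.lt_inv_iff_lt_inv, ← ENNReal.ofReal_inv_of_pos (by positivity), one_div, inv_inv,
      ← ENNReal.ofReal_coe_nnreal]
    refine (ENNReal.ofReal_lt_ofReal_iff (one_pos.trans hlam)).2 ?_
    exact_mod_cast rpow_lt_of_lt_log_div_log hlam L.coe_nonneg (mod_cast hr₀) hr_log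
  have summable_mul := summable_norm_inv_pow_mul rpow_lt
  rw [NNReal.coe_rpow] at summable_mul
  have r_le_one : r ≤ 1 := mod_cast hr_one.le
  obtain ⟨K, D, edist_le⟩ := exists_edist_limitMap_le hp hsurj hθ hF hf hσ
    hA.summable_norm_inv_pow summable_mul r_le_one
  exact exists_seminorm_sub_le_mul_toReal_rpow N r_le_one edist_le R

end Holder

/-! ### The semiconjugacy to the toral endomorphism -/

section Torus

variable {b : ℕ}

theorem continuous_torusProj : Continuous (torusProj (b := b)) :=
  continuous_pi fun i => (AddCircle.continuous_mk' 1).comp (continuous_apply i)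

theorem torusProj_add_intCast (v : Fin b → ℝ) (n : Fin b → ℤ) :
    torusProj (v + fun i => (n i : ℝ)) = torusProj v := by
  ext i
  simp only [torusProj, Pi.add_apply, AddCircle.coe_add]
  rw [add_eq_left, AddCircle.coe_eq_zero_iff]
  exact ⟨n i, by simp⟩

theorem torusProj_realMatrix_mulVec (A : Matrix (Fin b) (Fin b) ℤ) (v : Fin b → ℝ) :
    torusProj (realMatrix A *ᵥ v) = toralEndomorphism A (torusProj v) := by
  ext i
  change QuotientAddGroup.mk' _ (∑ j, (A i j : ℝ) * v j) = _
  rw [map_sum]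
  refine Finset.sum_congr rfl fun j _ => ?_
  rw [← zsmul_eq_mul, map_zsmul]
  rfl

end Torus

section Descent

variable {b : ℕ} {M : Type u} [TopologicalSpace M] {E : Type v} [TopologicalSpace E] {p : C(E, M)}

theorem surjective_of_isCoveringMap [PathConnectedSpace M] [Nonempty E] (hp : IsCoveringMap p) :
    Function.Surjective p := by
  intro m
  obtain ⟨x⟩ := ‹Nonempty E›
  let γ := PathConnectedSpace.somePath (p x) m
  obtain ⟨Γ, hΓ, -⟩ := hp.exists_path_lifts γ x γ.source
  exact ⟨Γ 1, (congrFun hΓ 1).trans γ.target⟩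

theorem exists_continuousMap_semiconj_toralEndomorphism (hp : IsQuotientMap p)
    (g : C(E, Fin b → ℝ)) (hg : ∀ x y, p x = p y → ∃ n : Fin b → ℤ, g y = g x + fun i => (n i : ℝ))
    {A : Matrix (Fin b) (Fin b) ℤ} {f : M → M} {F : E → E} (hF : ∀ x, p (F x) = f (p x))
    (hgF : ∀ x, g (F x) = realMatrix A *ᵥ g x) :
    ∃ β : C(M, Fin b → UnitAddCircle), (∀ x, β (p x) = torusProj (g x)) ∧
      Function.Semiconj β f (toralEndomorphism A) := by
  let k : C(E, Fin b → UnitAddCircle) := ⟨torusProj ∘ g, continuous_torusProj.comp g.continuous⟩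
  have factorsThrough : Function.FactorsThrough k p := fun x y h => by
    obtain ⟨n, hn⟩ := hg x y h
    change torusProj (g x) = torusProj (g y)
    rw [hn, torusProj_add_intCast]
  have lift_apply : ∀ x, hp.lift k factorsThrough (p x) = torusProj (g x) :=
    DFunLike.congr_fun (hp.lift_comp k factorsThrough)
  refine ⟨hp.lift k factorsThrough, lift_apply, hp.surjective.forall.2 fun x => ?_⟩
  rw [← hF, lift_apply, lift_apply, hgF, torusProj_realMatrix_mulVec]

theorem surjective_of_isUniversalAbelianCover [LocallyPathConnectedSpace M] [ConnectedSpace M]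
    (hp : IsUniversalAbelianCover p) : Function.Surjective p := by
  have := hp.pathConnectedSpace
  have := pathConnectedSpace_iff_connectedSpace (X := M).2 inferInstance
  exact surjective_of_isCoveringMap hp.isCoveringMap

variable {d : ℕ} [ChartedSpace (EuclideanSpace ℝ (Fin d)) M] [IsManifold (𝓡 d) ∞ M]
  {θ : Fin b → OneForm d M} {Γ : Module.Basis (Fin b) ℤ (H1 M)} {f : C(M, M)} {F : C(E, E)}

theorem exists_displacement (hp : IsUniversalAbelianCover p) (hsurj : Function.Surjective p)
    (hθ : ∀ i, (θ i).IsSmoothClosed)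
    (hdual : ∀ i j, (θ i).HasPeriod (Γ j) (if i = j then 1 else 0)) (x₀ : E)
    (hF : ∀ x, p (F x) = f (p x)) :
    ∃ σ : C(M, Fin b → ℝ), ∀ x, σ (p x) =
      abelJacobi p θ x₀ (F x) - realMatrix (homologyMatrix Γ f) *ᵥ abelJacobi p θ x₀ x := by
  have hι := continuous_abelJacobi hp hθ x₀
  let g : C(E, Fin b → ℝ) :=
    ⟨fun x => abelJacobi p θ x₀ (F x) - realMatrix (homologyMatrix Γ f) *ᵥ abelJacobi p θ x₀ x,
      (hι.comp F.continuous).sub (continuous_const.matrix_mulVec hι)⟩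
  have factorsThrough : Function.FactorsThrough g p := fun x y h => by
    obtain ⟨n, hn, hnF⟩ := exists_abelJacobi_eq_add_intCast hp hθ hdual x₀ hF h
    simp only [g, ContinuousMap.coe_mk, hn, hnF, Matrix.mulVec_add, add_sub_add_right_eq_sub]
  have hquot := hp.isCoveringMap.isQuotientMap hsurj
  exact ⟨hquot.lift g factorsThrough, DFunLike.congr_fun (hquot.lift_comp g factorsThrough)⟩

end Descent

end

theorem mainTheorem1 {d b : ℕ}
    -- a compact connected smooth Riemannian manifold `M`, with its Riemannian distance
    {M : Type u} [MetricSpace M] [CompactSpace M] [ConnectedSpace M]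
    [ChartedSpace (EuclideanSpace ℝ (Fin d)) M] [IsManifold (𝓡 d) ∞ M]
    [RiemannianBundle (fun x : M => TangentSpace (𝓡 d) x)]
    [IsContMDiffRiemannianBundle (𝓡 d) ∞ (EuclideanSpace ℝ (Fin d))
      (fun x : M => TangentSpace (𝓡 d) x)]
    [IsRiemannianManifold (𝓡 d) M]
    -- the universal Abelian cover
    {E : Type v} [TopologicalSpace E] (p : C(E, M)) (hp : IsUniversalAbelianCover p)
    -- a basis of `H₁(M; ℤ)` and a dual family of closed one-forms
    (Γ : Module.Basis (Fin b) ℤ (H1 M)) (θ : Fin b → OneForm d M)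
    (hθ : ∀ i, (θ i).IsSmoothClosed)
    (hdual : ∀ i j, (θ i).HasPeriod (Γ j) (if i = j then 1 else 0))
    (x₀ : E)
    -- the map `f`, a lift `F`, and the action on homology
    (f : C(M, M)) (F : C(E, E)) (hF : ∀ x, p (F x) = f (p x))
    (hexp : IsExpandingMatrix (homologyMatrix Γ f))
    -- a norm on `ℝ^b`
    (N : Seminorm ℝ (Fin b → ℝ)) (hN : ∀ v, N v = 0 → v = 0) :
    let A := realMatrix (homologyMatrix Γ f)
    let ι := abelJacobi p θ x₀
    let Φ := toralEndomorphism (homologyMatrix Γ f)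
    ∃ (σ : C(M, Fin b → ℝ)) (βt : C(E, Fin b → ℝ)) (β : C(M, Fin b → UnitAddCircle)),
      -- the displacement `σ`, the limit and the series
      (∀ x, σ (p x) = ι (F x) - A *ᵥ ι x) ∧
      (∀ x, Tendsto (fun n : ℕ => (A⁻¹) ^ n *ᵥ ι (F^[n] x)) atTop (𝓝 (βt x))) ∧
      (∀ x, HasSum (fun n : ℕ => (A⁻¹) ^ (n + 1) *ᵥ σ (f^[n] (p x))) (βt x - ι x)) ∧
      -- Hölder regularity on bounded scales, for the lifted Riemannian distance
      (∀ lam : ℝ, 1 < lam →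
        spectralRadius ℂ (complexMatrix (homologyMatrix Γ f))⁻¹ < ENNReal.ofReal (1 / lam) →
        ∀ L : ℝ≥0, LipschitzWith L f →
        ∀ ν : ℝ, 0 < ν → ν < min (Real.log lam / Real.log L) 1 →
        ∀ R : ℝ, ∃ C : ℝ, ∀ x y : E, coverEDist d p x y ≤ ENNReal.ofReal R →
          N (βt x - βt y) ≤ C * (coverEDist d p x y).toReal ^ ν) ∧
      -- equivariance
      (∀ (n : Fin b → ℤ) (δ : E ≃ₜ E), IsDeckTransformation p Γ n δ →
        ∀ x, βt (δ x) = βt x + fun i => (n i : ℝ)) ∧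
      (∀ x, βt (F x) = A *ᵥ βt x) ∧
      -- the semiconjugacy
      (∀ x, β (p x) = torusProj (βt x)) ∧
      (∀ x, β (f x) = Φ (β x)) ∧
      IsCompact (range β) ∧ MapsTo Φ (range β) (range β) ∧
      (Function.Surjective f → Φ '' range β = range β) ∧
      -- global shadowing
      (∀ x y, GloballyShadows N ι F A x y ↔ y = βt x) ∧
      (∀ x, βt x = shadowingMap N ι F A x) := by
  intro A ι Φ
  have := ChartedSpace.locallyPathConnectedSpace (EuclideanSpace ℝ (Fin d)) M
  have hsurj := surjective_of_isUniversalAbelianCover hp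
  obtain ⟨σ, hσ⟩ := exists_displacement hp hsurj hθ hdual x₀ hF
  have hA := hexp.isUnit_det_realMatrix
  have hAinv := hexp.summable_norm_inv_pow
  let βt : C(E, Fin b → ℝ) := ⟨limitMap A ι p f σ, continuous_limitMap hAinv σ.norm_coe_le_norm
    (continuous_abelJacobi hp hθ x₀) p.continuous f.continuous σ.continuous⟩
  have hlim := tendsto_limitMap hA hAinv hF hσ σ.norm_coe_le_norm
  have hβF : ∀ x, βt (F x) = A *ᵥ βt x := apply_eq_mulVec_of_tendsto hA hlim
  obtain ⟨β, hβ, hβf⟩ := exists_continuousMap_semiconj_toralEndomorphism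
    (hp.isCoveringMap.isQuotientMap hsurj) βt (fun x y h =>
      (exists_abelJacobi_eq_add_intCast hp hθ hdual x₀ hF h).imp fun _ hn =>
        limitMap_eq_add h hn.1) hF hβF
  have hshadow (x : E) (y : Fin b → ℝ) : GloballyShadows N ι F A x y ↔ y = βt x :=
    globallyShadows_iff_eq_limitMap hN hA hAinv hF hσ σ.norm_coe_le_norm
  exact ⟨σ, βt, β, hσ, hlim, hasSum_limitMap_sub hAinv σ.norm_coe_le_norm,
    fun _ hlam hspec _ hf _ hν₀ hν =>
      exists_seminorm_limitMap_sub_le hp hsurj hθ hF hf hexp hσ hlam hspec hν₀ hν N,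
    fun n δ hδ x => limitMap_eq_add (hδ.choose x).symm
      (abelJacobi_deckTransformation hp hθ hdual x₀ hδ x),
    hβF, hβ, hβf, isCompact_range β.continuous, hβf.mapsTo_range,
    fun hf => hβf.mapsTo_range.image_subset.antisymm (hβf.surjOn_range hf), hshadow,
    fun x => (shadowingMap_eq_of_globallyShadows_iff (hshadow x)).symm⟩
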